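/- **Theorem 3.3.** Let $T>0$, $x_0\in(0,1)$ and $\mathcal O_T=[0,T]\times[0,1]$. Let $u_0\in C^2([0,1];\mathbb R)$ with $u_0(0)=u_0(1)=0$, let $v_0\in C^1([0,1];\mathbb R)$, and let $b,\sigma:\mathbb R\to\mathbb R$ be globally Lipschitz continuous, that is, for some $L>0$, $$|b(x)-b(y)|+|\sigma(x)-\sigma(y)|\le L|x-y|\qquad\text{for all }x,y\in\mathbb R.$$ *Continuous problem.* Put $\varphi_j(x)=\sqrt2\sin(j\pi x)$ and let $$G_t(x,z)=\sum_{j=1}^{\infty}\frac{\sin(j\pi t)}{j\pi}\varphi_j(x)\varphi_j(z)$$ (limit of partial sums) be the Green function of $\partial_t^2-\partial_x^2$ on $[0,1]$ with homogeneous Dirichlet boundary conditions. For $h\in L^2(\mathcal O_T;\mathbb R)$ let $\Upsilon(h)\in C(\mathcal O_T;\mathbb R)$ be the solution $f$ of the skeleton equation $$f(t,x)=\int_0^1G_t(x,z)v_0(z)\,dz+\frac{\partial}{\partial t}\Big(\int_0^1G_t(x,z)u_0(z)\,dz\Big)+\int_0^t\!\!\int_0^1G_{t-s}(x,z)\,\big[b(f(s,z))+\sigma(f(s,z))h(s,z)\big]\,dz\,ds,\quad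 (t,x)\in\mathcal O_T,$$ of the stochastic wave equation $\partial_t^2u^\varepsilon=\partial_x^2u^\varepsilon+b(u^\varepsilon)+\sqrt\varepsilon\,\sigma(u^\varepsilon)\dot W$ with homogeneous Dirichlet boundary conditions and initial data $u^\varepsilon(0,\cdot)=u_0$, $\partial_tu^\varepsilon(0,\cdot)=v_0$. *Discrete problem.* For a positive integer $n$ put $\kappa_n(z)=\lfloor zn\rfloor/n$, $c^n_j=\sin^2(\tfrac{j\pi}{2n})/(\tfrac{j\pi}{2n})^2$, let $\varphi_{j,n}$ be the piecewise linear interpolation of $\varphi_j$ with nodes $0,\tfrac1n,\dots,1$, and let $$G^n_t(x,z)=\sum_{j=1}^{n-1}\frac{\sin(j\pi t\sqrt{c^n_j})}{j\pi\sqrt{c^n_j}}\,\varphi_{j,n}(x)\,\varphi_j(\kappa_n(z)).$$ Let $\Upsilon^n(h)\in C(\mathcal O_T;\mathbb R)$ be the solution $f$ of the skeleton equation of the spatial finite difference method with mesh size $1/n$: $$\begin{aligned}f(t,x)={}&\int_0^1G^n_t(x,z)v_0(\kappa_n(z))\,dz+\int_0^1\frac{\partial}{\partial t}G^n_t(x,z)\,u_0(\kappa_n(z))\,dz\\&+\int_0^t\!\!\int_0^1G^n_{t-s}(x,z)\,\big[b(f(s,\kappa_n(z)))+\sigma(f(s,\kappa_n(z)))h(s,z)\big]\,dz\,ds,\quad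 (t,x)\in\mathcal O_T.\end{aligned}$$ *One-point rate functions.* For $y\in\mathbb R$ define, with $\inf\emptyset=+\infty$, $$I(y)=\inf_{\substack{f\in C(\mathcal O_T;\mathbb R)\\ f(T,x_0)=y}}\ \inf_{\substack{h\in L^2(\mathcal O_T;\mathbb R)\\ \Upsilon(h)=f}}\tfrac12\|h\|^2_{L^2(\mathcal O_T)},\qquad I^n(y)=\inf_{\substack{f\in C(\mathcal O_T;\mathbb R)\\ f(T,x_0)=y}}\ \inf_{\substack{h\in L^2(\mathcal O_T;\mathbb R)\\ \Upsilon^n(h)=f}}\tfrac12\|h\|^2_{L^2(\mathcal O_T)}.$$ Assume that $\sigma(x)\ne0$ for every $x\in\mathbb R$. Then $$\lim_{n\to\infty}I^n(y)=I(y)\quad\text{in }[0,+\infty]\qquad\text{for every }y\in\mathbb R.$$ -/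

import Mathlib

open Set Filter Topology MeasureTheory
open scoped ENNReal

namespace WaveLDP

noncomputable section

/-- The space-time rectangle `O_T = [0,T] × [0,1]`. -/
def spaceTime (T : ℝ) : Set (ℝ × ℝ) := Icc 0 T ×ˢ Icc 0 1

/-- The Hilbert space `L²(O_T; ℝ)` of controls. -/
abbrev Control (T : ℝ) : Type := Lp ℝ 2 ((volume : Measure (ℝ × ℝ)).restrict (spaceTime T))

/-- The Dirichlet eigenfunctions `φ_j(x) = √2 sin(jπx)`. -/
def phi (j : ℕ) (x : ℝ) : ℝ := √2 * Real.sin (j * Real.pi * x)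

/-- Partial sums of the series of the Green function of `∂²/∂t² - ∂²/∂x²` on `[0,1]` with
homogeneous Dirichlet boundary conditions. -/
def greenPartial (N : ℕ) (t x y : ℝ) : ℝ :=
  ∑ j ∈ Finset.Icc 1 N, Real.sin (j * Real.pi * t) / (j * Real.pi) * phi j x * phi j y

/-- The Green function `G_t(x,y) = ∑_{j ≥ 1} sin(jπt)/(jπ) φ_j(x) φ_j(y)`. The series converges
only conditionally, so it is the limit of its partial sums; the limit exists for all real
`t, x, y` (see `exists_tendsto_greenPartial`). -/
def green (t x y : ℝ) : ℝ := limUnder atTop fun N : ℕ => greenPartial N t x y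

lemma exists_tendsto_sin_series (θ : ℝ) :
    ∃ l, Tendsto (fun N : ℕ => ∑ j ∈ Finset.Icc 1 N, Real.sin (j * θ) / j) atTop (𝓝 l) := by
  have hb : ∃ B, ∀ n : ℕ, ‖∑ j ∈ Finset.range n, Real.sin ((j + 1 : ℕ) * θ)‖ ≤ B := by
    by_cases hs : Real.sin (θ / 2) = 0
    · refine ⟨0, fun n => ?_⟩
      have h0 : ∀ j : ℕ, Real.sin ((j + 1 : ℕ) * θ) = 0 := by
        intro j
        obtain ⟨k, hk⟩ := Real.sin_eq_zero_iff.1 hs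
        rw [Real.sin_eq_zero_iff]
        refine ⟨(j + 1 : ℕ) * (2 * k), ?_⟩
        push_cast
        linear_combination (2 * ((j : ℝ) + 1)) * hk
      rw [Finset.sum_eq_zero fun j _ => h0 j, norm_zero]
    · refine ⟨1 / |Real.sin (θ / 2)|, fun n => ?_⟩
      have tel : ∀ n : ℕ, 2 * Real.sin (θ / 2) * ∑ j ∈ Finset.range n, Real.sin ((j + 1 : ℕ) * θ)
          = Real.cos (θ / 2) - Real.cos (n * θ + θ / 2) := by
        intro n
        induction n with
        | zero => simp
        | succ n ih =>
          rw [Finset.sum_range_succ, mul_add, ih]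
          have e2 : (n : ℝ) * θ + θ / 2 = ((n + 1 : ℕ) : ℝ) * θ - θ / 2 := by push_cast; ring
          rw [e2, Real.cos_sub, Real.cos_add]
          ring
      have hpos : 0 < |Real.sin (θ / 2)| := abs_pos.2 hs
      rw [le_div_iff₀ hpos, Real.norm_eq_abs, ← abs_mul]
      have h2 := tel n
      rw [abs_le]
      constructor <;>
        nlinarith [Real.cos_le_one (θ / 2), Real.neg_one_le_cos (θ / 2),
          Real.cos_le_one (n * θ + θ / 2), Real.neg_one_le_cos (n * θ + θ / 2)]
  obtain ⟨B, hB⟩ := hb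
  have hanti : Antitone fun n : ℕ => 1 / ((n : ℝ) + 1) := fun m n hmn =>
    one_div_le_one_div_of_le (by positivity) (by gcongr)
  have hc := hanti.cauchySeq_series_mul_of_tendsto_zero_of_bounded
    tendsto_one_div_add_atTop_nhds_zero_nat hB
  obtain ⟨l, hl⟩ := cauchySeq_tendsto_of_complete hc
  refine ⟨l, hl.congr fun N => ?_⟩
  induction N with
  | zero => simp
  | succ N ih =>
    rw [Finset.sum_range_succ, ih, Finset.sum_Icc_succ_top (by omega)]
    push_cast
    simp only [smul_eq_mul]
    ring

lemma exists_tendsto_greenPartial (t x y : ℝ) :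
    ∃ l, Tendsto (fun N : ℕ => greenPartial N t x y) atTop (𝓝 l) := by
  obtain ⟨l₁, h₁⟩ := exists_tendsto_sin_series (Real.pi * (t + x - y))
  obtain ⟨l₂, h₂⟩ := exists_tendsto_sin_series (Real.pi * (x + y - t))
  obtain ⟨l₃, h₃⟩ := exists_tendsto_sin_series (Real.pi * (y + t - x))
  obtain ⟨l₄, h₄⟩ := exists_tendsto_sin_series (Real.pi * (t + x + y))
  refine ⟨_, (((((h₁.add h₂).add h₃).sub h₄).const_mul (1 / (2 * Real.pi)))).congr fun N => ?_⟩
  rw [greenPartial, ← Finset.sum_add_distrib, ← Finset.sum_add_distrib, ← Finset.sum_sub_distrib,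
    Finset.mul_sum]
  refine Finset.sum_congr rfl fun j hj => ?_
  have hj0 : (j : ℝ) ≠ 0 := by
    have := (Finset.mem_Icc.1 hj).1
    positivity
  have hpi := Real.pi_ne_zero
  have h2 : √2 * √2 = (2 : ℝ) := Real.mul_self_sqrt (by norm_num)
  have e : ∀ a b c : ℝ, Real.sin (a + b - c) + Real.sin (b + c - a) + Real.sin (c + a - b)
      - Real.sin (a + b + c) = 4 * (Real.sin a * Real.sin b * Real.sin c) := by
    intro a b c
    simp only [Real.sin_add, Real.sin_sub, Real.cos_add]
    ring
  have e' := e (j * Real.pi * t) (j * Real.pi * x) (j * Real.pi * y)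
  rw [show (j : ℝ) * (Real.pi * (t + x - y)) = j * Real.pi * t + j * Real.pi * x - j * Real.pi * y
      by ring,
    show (j : ℝ) * (Real.pi * (x + y - t)) = j * Real.pi * x + j * Real.pi * y - j * Real.pi * t
      by ring,
    show (j : ℝ) * (Real.pi * (y + t - x)) = j * Real.pi * y + j * Real.pi * t - j * Real.pi * x
      by ring,
    show (j : ℝ) * (Real.pi * (t + x + y)) = j * Real.pi * t + j * Real.pi * x + j * Real.pi * y
      by ring, ← add_div, ← add_div, ← sub_div, e']
  unfold phi
  generalize Real.sin (j * Real.pi * t) = A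
  generalize Real.sin (j * Real.pi * x) = B
  generalize Real.sin (j * Real.pi * y) = C
  field_simp
  linear_combination (-2 * A * B * C) * h2

/-- The grid projection `κ_n(z) = ⌊zn⌋ / n`. -/
def kappa (n : ℕ) (z : ℝ) : ℝ := (⌊z * n⌋ : ℝ) / n

/-- The piecewise linear interpolation `Π_n(w)` of `w` with nodes `0, 1/n, …, 1`. -/
def interp (n : ℕ) (w : ℝ → ℝ) (x : ℝ) : ℝ :=
  w (kappa n x) + (n * x - (⌊n * x⌋ : ℝ)) * (w (kappa n x + 1 / n) - w (kappa n x))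

/-- `c_j^n = sin²(jπ/(2n)) / (jπ/(2n))²`. -/
def discCoeff (n j : ℕ) : ℝ :=
  Real.sin (j / (2 * n) * Real.pi) ^ 2 / (j / (2 * n) * Real.pi) ^ 2

/-- The discrete Green function
`G^n_t(x,y) = ∑_{j=1}^{n-1} sin(jπt√c_j^n)/(jπ√c_j^n) Π_n(φ_j)(x) φ_j(κ_n(y))`. -/
def discGreen (n : ℕ) (t x y : ℝ) : ℝ :=
  ∑ j ∈ Finset.Icc 1 (n - 1),
    Real.sin (j * Real.pi * t * √(discCoeff n j)) / (j * Real.pi * √(discCoeff n j))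
      * interp n (phi j) x * phi j (kappa n y)

/-- `f = Υ(h)`: the path `f` solves on `O_T` the skeleton equation of the stochastic wave
equation with control `h`. -/
def IsSkeleton (T : ℝ) (u₀ v₀ b σ : ℝ → ℝ) (h : Control T) (f : ℝ × ℝ → ℝ) : Prop :=
  ∀ t ∈ Icc 0 T, ∀ x ∈ Icc (0 : ℝ) 1,
    f (t, x) = (∫ z in (0 : ℝ)..1, green t x z * v₀ z)
      + deriv (fun r => ∫ z in (0 : ℝ)..1, green r x z * u₀ z) t
      + (∫ p in Icc 0 t ×ˢ Icc (0 : ℝ) 1, green (t - p.1) x p.2 * b (f p))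
      + ∫ p in Icc 0 t ×ˢ Icc (0 : ℝ) 1, green (t - p.1) x p.2 * σ (f p) * h p

/-- `f = Υ^n(h)`: the path `f` solves on `O_T` the skeleton equation of the spatial finite
difference method with `n` mesh intervals, with control `h`. -/
def IsDiscSkeleton (n : ℕ) (T : ℝ) (u₀ v₀ b σ : ℝ → ℝ) (h : Control T) (f : ℝ × ℝ → ℝ) : Prop :=
  ∀ t ∈ Icc 0 T, ∀ x ∈ Icc (0 : ℝ) 1,
    f (t, x) = (∫ z in (0 : ℝ)..1, discGreen n t x z * v₀ (kappa n z))
      + (∫ z in (0 : ℝ)..1, deriv (fun r => discGreen n r x z) t * u₀ (kappa n z))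
      + (∫ p in Icc 0 t ×ˢ Icc (0 : ℝ) 1,
          discGreen n (t - p.1) x p.2 * b (f (p.1, kappa n p.2)))
      + ∫ p in Icc 0 t ×ˢ Icc (0 : ℝ) 1,
          discGreen n (t - p.1) x p.2 * σ (f (p.1, kappa n p.2)) * h p

/-- The sample path rate `J(f) = inf {½‖h‖² : h ∈ L²(O_T), Υ(h) = f}`, with `inf ∅ = ∞`. -/
def pathRate (T : ℝ) (u₀ v₀ b σ : ℝ → ℝ) (f : ℝ × ℝ → ℝ) : ℝ≥0∞ :=
  ⨅ (h : Control T) (_ : IsSkeleton T u₀ v₀ b σ h f), ENNReal.ofReal (1 / 2 * ‖h‖ ^ 2)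

/-- The sample path rate `J^n(f) = inf {½‖h‖² : h ∈ L²(O_T), Υ^n(h) = f}`, with `inf ∅ = ∞`. -/
def discPathRate (n : ℕ) (T : ℝ) (u₀ v₀ b σ : ℝ → ℝ) (f : ℝ × ℝ → ℝ) : ℝ≥0∞ :=
  ⨅ (h : Control T) (_ : IsDiscSkeleton n T u₀ v₀ b σ h f), ENNReal.ofReal (1 / 2 * ‖h‖ ^ 2)

/-- The one-point rate function `I(y) = inf {J(f) : f ∈ C(O_T), f(T,x₀) = y}`. -/
def pointRate (T x₀ : ℝ) (u₀ v₀ b σ : ℝ → ℝ) (y : ℝ) : ℝ≥0∞ :=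
  ⨅ (f : ℝ × ℝ → ℝ) (_ : ContinuousOn f (spaceTime T)) (_ : f (T, x₀) = y),
    pathRate T u₀ v₀ b σ f

/-- The one-point rate function `I^n(y) = inf {J^n(f) : f ∈ C(O_T), f(T,x₀) = y}`. -/
def discPointRate (n : ℕ) (T x₀ : ℝ) (u₀ v₀ b σ : ℝ → ℝ) (y : ℝ) : ℝ≥0∞ :=
  ⨅ (f : ℝ × ℝ → ℝ) (_ : ContinuousOn f (spaceTime T)) (_ : f (T, x₀) = y),
    discPathRate n T u₀ v₀ b σ f

end

end WaveLDP

/-! Since σ never vanishes, a control can be recovered from a path and its source. Let f solve one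
of the two skeleton equations with control h, and treat F = b(f) + σ(f)h (with f evaluated at κ_n in
the discrete case) as a given L² density. Inserting F into the other equation produces an explicit
path, so no fixed point has to be solved. This path is uniformly close to f, because the Green
functions are L²-close in z uniformly in time and space, and the initial parts are uniformly close.
Adding dψ to F, for a fixed source ψ whose response at (T, x₀) is positive and a small number d,
restores the value y exactly. If f' is the corrected path, then h' = (F + dψ - b(f'))/σ(f'), with
κ_n inserted where needed, is a control for f', and it is L²-close to h because |σ| is bounded below
on compact sets. The two halves of this construction are `exists_transfer_path` and
`exists_control_uniform`. Existence and uniqueness of skeleton solutions play no role.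

Going from the continuous to the discrete problem, one control is kept fixed, and limsup Iⁿ(y) ≤
I(y) follows. The converse needs a threshold in n that serves all discrete controls of norm at most
a. The a priori bound `exists_abs_le_of_solvesSkeleton` supplies uniform bounds for f and F, and the
equicontinuity of the Duhamel integrals handles the evaluation at grid points.

The convergence of the kernels, `eventually_hasL2Bound_discGreen_sub`, is a Parseval argument: φ_j
and φ_j ∘ κ_n are orthonormal families and all coefficients are at most 1/j, so the modes beyond J
contribute at most 1/√J in L², uniformly in n, while each remaining mode converges. The initial
position lacks the factor 1/j. There, C² regularity and summation by parts on the grid give sine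
coefficients of order j⁻², uniformly in n. -/

namespace WaveLDP

noncomputable section

/-- Lebesgue measure on the unit interval. -/
abbrev unitMeasure : Measure ℝ := volume.restrict (Icc 0 1)

/-- Lebesgue measure on the space-time rectangle. -/
abbrev spaceTimeMeasure (T : ℝ) : Measure (ℝ × ℝ) := volume.restrict (spaceTime T)

instance : IsProbabilityMeasure unitMeasure := ⟨by simp [unitMeasure]⟩

lemma measurableSet_spaceTime (T : ℝ) : MeasurableSet (spaceTime T) :=
  measurableSet_Icc.prod measurableSet_Icc

lemma isCompact_spaceTime (T : ℝ) : IsCompact (spaceTime T) := isCompact_Icc.prod isCompact_Icc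

lemma spaceTimeMeasure_eq_prod (T : ℝ) :
    spaceTimeMeasure T = (volume.restrict (Icc 0 T)).prod unitMeasure := by
  rw [Measure.prod_restrict]; rfl

instance (T : ℝ) : IsFiniteMeasure (spaceTimeMeasure T) := by
  rw [spaceTimeMeasure_eq_prod]; infer_instance

lemma integral_unitMeasure (f : ℝ → ℝ) : ∫ z, f z ∂unitMeasure = ∫ z in (0 : ℝ)..1, f z := by
  rw [intervalIntegral.integral_of_le zero_le_one, integral_Icc_eq_integral_Ioc]

/-! ### Quantitative L² bounds, Cauchy–Schwarz and Parseval -/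

section L2

variable {α : Type*} [MeasurableSpace α] {μ : Measure α}

/-- The function `f` is measurable with `L²(μ)` norm at most `A`. -/
structure HasL2Bound (μ : Measure α) (f : α → ℝ) (A : ℝ) : Prop where
  aesm : AEStronglyMeasurable f μ
  nonneg : 0 ≤ A
  le : eLpNorm f 2 μ ≤ ENNReal.ofReal A

lemma HasL2Bound.memLp {f : α → ℝ} {A : ℝ} (hf : HasL2Bound μ f A) : MemLp f 2 μ :=
  ⟨hf.aesm, hf.le.trans_lt ENNReal.ofReal_lt_top⟩

lemma HasL2Bound.mono {f : α → ℝ} {A B : ℝ} (hf : HasL2Bound μ f A) (h : A ≤ B) :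
    HasL2Bound μ f B :=
  ⟨hf.aesm, hf.nonneg.trans h, hf.le.trans (ENNReal.ofReal_le_ofReal h)⟩

lemma HasL2Bound.add {f g : α → ℝ} {A B : ℝ} (hf : HasL2Bound μ f A) (hg : HasL2Bound μ g B) :
    HasL2Bound μ (fun x => f x + g x) (A + B) :=
  ⟨hf.aesm.add hg.aesm, add_nonneg hf.nonneg hg.nonneg, by
    rw [ENNReal.ofReal_add hf.nonneg hg.nonneg]
    exact (eLpNorm_add_le hf.aesm hg.aesm (by norm_num)).trans (add_le_add hf.le hg.le)⟩

lemma HasL2Bound.sub {f g : α → ℝ} {A B : ℝ} (hf : HasL2Bound μ f A) (hg : HasL2Bound μ g B) :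
    HasL2Bound μ (fun x => f x - g x) (A + B) :=
  ⟨hf.aesm.sub hg.aesm, add_nonneg hf.nonneg hg.nonneg, by
    rw [ENNReal.ofReal_add hf.nonneg hg.nonneg]
    exact (eLpNorm_sub_le hf.aesm hg.aesm (by norm_num)).trans (add_le_add hf.le hg.le)⟩

lemma HasL2Bound.congr {f g : α → ℝ} {A : ℝ} (hf : HasL2Bound μ f A) (h : f =ᵐ[μ] g) :
    HasL2Bound μ g A :=
  ⟨hf.aesm.congr h, hf.nonneg, (eLpNorm_congr_ae h).symm.le.trans hf.le⟩

lemma HasL2Bound.of_abs_le_mul {f g : α → ℝ} {A c : ℝ} (hg : HasL2Bound μ g A) (hc : 0 ≤ c)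
    (hf : AEStronglyMeasurable f μ) (h : ∀ᵐ x ∂μ, |f x| ≤ c * |g x|) :
    HasL2Bound μ f (c * A) :=
  ⟨hf, mul_nonneg hc hg.nonneg, by
    rw [ENNReal.ofReal_mul hc]
    exact (eLpNorm_le_mul_eLpNorm_of_ae_le_mul h 2).trans (by gcongr; exact hg.le)⟩

lemma HasL2Bound.of_abs_le {f : α → ℝ} {c : ℝ} [IsFiniteMeasure μ] (hc : 0 ≤ c)
    (hf : AEStronglyMeasurable f μ) (h : ∀ᵐ x ∂μ, |f x| ≤ c) :
    HasL2Bound μ f (c * √(μ.real univ)) :=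
  ⟨hf, by positivity, by
    refine (eLpNorm_le_of_ae_bound h).trans ?_
    rw [mul_comm c, ENNReal.ofReal_mul (Real.sqrt_nonneg _)]
    gcongr
    rw [Real.sqrt_eq_rpow, ← ENNReal.ofReal_rpow_of_nonneg (by positivity) (by norm_num),
      Measure.real, ENNReal.ofReal_toReal (measure_ne_top _ _)]
    norm_num⟩

lemma HasL2Bound.of_abs_le_unit {f : ℝ → ℝ} {c : ℝ} (hc : 0 ≤ c)
    (hf : AEStronglyMeasurable f unitMeasure) (h : ∀ z ∈ Icc (0 : ℝ) 1, |f z| ≤ c) :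
    HasL2Bound unitMeasure f c := by
  have := HasL2Bound.of_abs_le hc hf (by filter_upwards [ae_restrict_mem measurableSet_Icc] with z hz
                                         exact h z hz)
  simpa using this

lemma eLpNorm_two_sq (f : α → ℝ) : eLpNorm f 2 μ ^ 2 = ∫⁻ x, ENNReal.ofReal (f x ^ 2) ∂μ := by
  have := eLpNorm_nnreal_pow_eq_lintegral (f := f) (μ := μ) (p := 2) (by norm_num)
  simp only [NNReal.coe_ofNat, ENNReal.coe_ofNat, ENNReal.rpow_ofNat] at this
  rw [this]
  refine lintegral_congr fun x => ?_
  rw [← sq_abs, ENNReal.ofReal_pow (abs_nonneg _), ← Real.norm_eq_abs, ofReal_norm]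

lemma eLpNorm_two_le_iff {f : α → ℝ} {A : ℝ} (hA : 0 ≤ A) :
    eLpNorm f 2 μ ≤ ENNReal.ofReal A ↔
      ∫⁻ x, ENNReal.ofReal (f x ^ 2) ∂μ ≤ ENNReal.ofReal (A ^ 2) := by
  rw [← eLpNorm_two_sq, ENNReal.ofReal_pow hA]
  exact (ENNReal.pow_le_pow_left_iff two_ne_zero).symm

lemma abs_integral_mul_le {f g : α → ℝ} {A B : ℝ} (hf : HasL2Bound μ f A)
    (hg : HasL2Bound μ g B) : |∫ x, f x * g x ∂μ| ≤ A * B := by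
  have h := norm_inner_le_norm (𝕜 := ℝ) (hf.memLp.toLp f) (hg.memLp.toLp g)
  have h1 : inner ℝ (hf.memLp.toLp f) (hg.memLp.toLp g) = ∫ x, f x * g x ∂μ := by
    rw [L2.inner_def]
    refine integral_congr_ae ?_
    filter_upwards [hf.memLp.coeFn_toLp, hg.memLp.coeFn_toLp] with x h1 h2
    simp [h1, h2, mul_comm]
  rw [h1] at h
  refine h.trans (mul_le_mul ?_ ?_ (norm_nonneg _) hf.nonneg)
  · rw [Lp.norm_toLp]; exact ENNReal.toReal_le_of_le_ofReal hf.nonneg hf.le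
  · rw [Lp.norm_toLp]; exact ENNReal.toReal_le_of_le_ofReal hg.nonneg hg.le

lemma HasL2Bound.integrable_mul {f g : α → ℝ} {A B : ℝ} (hf : HasL2Bound μ f A)
    (hg : HasL2Bound μ g B) : Integrable (fun x => f x * g x) μ :=
  hf.memLp.integrable_mul hg.memLp

/-- Parseval for a finite family. Every L² estimate of a truncated Green function reduces to square
sums of coefficients through this lemma. -/
lemma hasL2Bound_sum_of_orthonormal {ι : Type*} [DecidableEq ι] (S : Finset ι) (e : ι → α → ℝ)
    (c : ι → ℝ) (he : ∀ i ∈ S, MemLp (e i) 2 μ)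
    (horth : ∀ i ∈ S, ∀ j ∈ S, ∫ x, e i x * e j x ∂μ = if i = j then 1 else 0)
    {A : ℝ} (hA : 0 ≤ A) (hc : ∑ i ∈ S, c i ^ 2 ≤ A ^ 2) :
    HasL2Bound μ (fun x => ∑ i ∈ S, c i * e i x) A := by
  have hm : MemLp (fun x => ∑ i ∈ S, c i * e i x) 2 μ :=
    memLp_finsetSum S fun i hi => (he i hi).const_mul (c i)
  refine ⟨hm.1, hA, (eLpNorm_two_le_iff hA).2 ?_⟩
  rw [← ofReal_integral_eq_lintegral_ofReal hm.integrable_sq (ae_of_all _ fun x => sq_nonneg _)]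
  refine ENNReal.ofReal_le_ofReal (le_trans (le_of_eq ?_) hc)
  have h1 : ∀ x, (∑ i ∈ S, c i * e i x) ^ 2
      = ∑ i ∈ S, ∑ j ∈ S, c i * c j * (e i x * e j x) := fun x => by
    rw [sq, Finset.sum_mul_sum]
    exact Finset.sum_congr rfl fun i _ => Finset.sum_congr rfl fun j _ => by ring
  have hi : ∀ i ∈ S, ∀ j ∈ S, Integrable (fun x => c i * c j * (e i x * e j x)) μ :=
    fun i hi j hj => ((he i hi).integrable_mul (he j hj)).const_mul _
  simp_rw [h1]
  rw [integral_finsetSum _ fun i h => integrable_finsetSum _ fun j h' => hi i h j h']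
  refine Finset.sum_congr rfl fun i h => ?_
  rw [integral_finsetSum _ fun j h' => hi i h j h', Finset.sum_eq_single i]
  · rw [integral_const_mul, horth i h i h]; simp [sq]
  · intro j hj hji
    rw [integral_const_mul, horth i h j hj, if_neg (Ne.symm hji), mul_zero]
  · exact fun h' => absurd h h'

end L2

/-- Tonelli: bounds in z at each fixed time are integrated over time. The time-dependent c is needed
for the exponentially weighted kernel. -/
lemma HasL2Bound.of_sections {T : ℝ} {A : ℝ × ℝ → ℝ} (hA : Measurable A) {c : ℝ → ℝ} {D : ℝ}
    (hD : 0 ≤ D) (hsec : ∀ s ∈ Icc 0 T, HasL2Bound unitMeasure (fun z => A (s, z)) (c s))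
    (hc : ∫⁻ s in Icc 0 T, ENNReal.ofReal (c s ^ 2) ≤ ENNReal.ofReal (D ^ 2)) :
    HasL2Bound (spaceTimeMeasure T) A D := by
  refine ⟨hA.aestronglyMeasurable, hD, (eLpNorm_two_le_iff hD).2 (le_trans ?_ hc)⟩
  rw [spaceTimeMeasure_eq_prod, lintegral_prod _ (by fun_prop)]
  refine setLIntegral_mono_ae' measurableSet_Icc (ae_of_all _ fun s hs => ?_)
  exact (eLpNorm_two_le_iff (hsec s hs).nonneg).1 (hsec s hs).le

lemma HasL2Bound.of_sections_const {T : ℝ} (hT : 0 ≤ T) {A : ℝ × ℝ → ℝ} (hA : Measurable A)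
    {c : ℝ} (hc : 0 ≤ c) (hsec : ∀ s ∈ Icc 0 T, HasL2Bound unitMeasure (fun z => A (s, z)) c) :
    HasL2Bound (spaceTimeMeasure T) A (c * √T) := by
  refine .of_sections hA (by positivity) hsec ?_
  rw [setLIntegral_const, Real.volume_Icc, ← ENNReal.ofReal_mul (sq_nonneg c), mul_pow,
    Real.sq_sqrt hT, sub_zero]

/-- Enlarging the domain to (-∞, t] gives a bound free of T. The gain 1/√(2l), small for large l,
makes the a priori estimate close on the whole time interval at once. -/
lemma lintegral_exp_weight_le {T t l : ℝ} (hl : 0 < l) (c : ℝ) :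
    ∫⁻ s in Icc 0 T, ENNReal.ofReal ((if s ≤ t then c * Real.exp (l * s) else 0) ^ 2)
      ≤ ENNReal.ofReal ((c * Real.exp (l * t) / √(2 * l)) ^ 2) := by
  have h1 : IntegrableOn (fun s => c ^ 2 * Real.exp (2 * l * s)) (Iic t) :=
    (integrableOn_exp_mul_Iic (by positivity) t).const_mul _
  calc _ ≤ ∫⁻ s, ENNReal.ofReal ((if s ≤ t then c * Real.exp (l * s) else 0) ^ 2) :=
        setLIntegral_le_lintegral _ _
    _ = ∫⁻ s in Iic t, ENNReal.ofReal (c ^ 2 * Real.exp (2 * l * s)) := by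
        rw [← lintegral_indicator measurableSet_Iic]
        refine lintegral_congr fun s => ?_
        by_cases hs : s ≤ t
        · rw [indicator_of_mem (show s ∈ Iic t from hs), if_pos hs, mul_pow, ← Real.exp_nat_mul]
          congr 3; push_cast; ring
        · rw [indicator_of_notMem (show s ∉ Iic t from hs), if_neg hs]; simp
    _ = ENNReal.ofReal (∫ s in Iic t, c ^ 2 * Real.exp (2 * l * s)) :=
        (ofReal_integral_eq_lintegral_ofReal h1 (ae_of_all _ fun s => by positivity)).symm
    _ ≤ _ := by
        refine ENNReal.ofReal_le_ofReal (le_of_eq ?_)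
        rw [integral_const_mul, integral_exp_mul_Iic (by positivity), div_pow, mul_pow,
          Real.sq_sqrt (by positivity), ← Real.exp_nat_mul]
        rw [mul_div_assoc]; congr 3; push_cast; ring


/-- Paths and data are continuous only on their domain and arbitrary elsewhere. Extension by zero
gives a globally measurable function that can be composed with κ_n. -/
lemma measurable_indicator_of_continuousOn {α : Type*} [TopologicalSpace α] [MeasurableSpace α]
    [OpensMeasurableSpace α] {s : Set α} {g : α → ℝ} (hg : ContinuousOn g s)
    (hs : MeasurableSet s) : Measurable (indicator s g) := by
  classical
  rw [← piecewise_eq_indicator]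
  exact hg.measurable_piecewise continuousOn_const hs

/-! ### The grid projection and Riemann sums -/

section Grid

variable {n : ℕ}

lemma kappa_le (hn : 0 < n) (z : ℝ) : kappa n z ≤ z := by
  rw [kappa, div_le_iff₀ (by positivity)]; exact Int.floor_le _

lemma lt_kappa_add (hn : 0 < n) (z : ℝ) : z < kappa n z + 1 / n := by
  rw [kappa, ← add_div, lt_div_iff₀ (by positivity)]; exact Int.lt_floor_add_one _

lemma abs_kappa_sub_le (hn : 0 < n) (z : ℝ) : |kappa n z - z| ≤ 1 / n := by
  rw [abs_le]; constructor <;> linarith [kappa_le hn z, lt_kappa_add hn z,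
    show (0 : ℝ) ≤ 1 / n by positivity]

lemma kappa_mem (hn : 0 < n) {z : ℝ} (hz : z ∈ Icc (0 : ℝ) 1) : kappa n z ∈ Icc (0 : ℝ) 1 := by
  refine ⟨?_, (kappa_le hn z).trans hz.2⟩
  have : (0 : ℤ) ≤ ⌊z * n⌋ := Int.floor_nonneg.2 (mul_nonneg hz.1 (by positivity))
  exact div_nonneg (by exact_mod_cast this) (by positivity)

lemma measurable_kappa (n : ℕ) : Measurable (kappa n) := by
  unfold kappa
  exact ((measurable_from_top (f := fun k : ℤ => (k : ℝ))).comp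
    (Int.measurable_floor.comp (measurable_id.mul_const _))).div_const _

lemma kappa_eq_of_mem (hn : 0 < n) (k : ℕ) {z : ℝ} (hz : z ∈ Ico ((k : ℝ) / n) ((k + 1 : ℕ) / n)) :
    kappa n z = k / n := by
  have h0 : (0 : ℝ) < n := by positivity
  have : ⌊z * n⌋ = (k : ℤ) := by
    rw [Int.floor_eq_iff]
    have h1 := (div_le_iff₀ h0).1 hz.1
    have h2 := (lt_div_iff₀ h0).1 hz.2
    push_cast at h2 ⊢
    exact ⟨h1, h2⟩
  rw [kappa, this]; simp

lemma integral_comp_kappa (hn : 0 < n) (g : ℝ → ℝ) :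
    ∫ z in (0 : ℝ)..1, g (kappa n z) = (∑ k ∈ Finset.range n, g (k / n)) / n := by
  have h0 : (n : ℝ) ≠ 0 := by positivity
  have key : ∀ k : ℕ, EqOn (fun z => g (kappa n z)) (fun _ => g (k / n))
      (Ico ((k : ℝ) / n) ((k + 1 : ℕ) / n)) := fun k z hz => by
    simp only [kappa_eq_of_mem hn k hz]
  have hle : ∀ k : ℕ, (k : ℝ) / n ≤ (k + 1 : ℕ) / n := fun k => by
    gcongr; simp
  -- κ_n is constant on intervals closed on the left, whereas interval integrals live on intervals
  -- closed on the right; the two differ by a null set.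
  have hae : ∀ k : ℕ, (fun _ => g (k / n)) =ᵐ[volume.restrict (Ioc ((k : ℝ) / n) ((k + 1 : ℕ) / n))]
      (fun z => g (kappa n z)) := fun k => by
    rw [← restrict_Ico_eq_restrict_Ioc]
    filter_upwards [ae_restrict_mem measurableSet_Ico] with z hz using (key k hz).symm
  have h1 := intervalIntegral.sum_integral_adjacent_intervals (μ := volume)
    (f := fun z => g (kappa n z)) (a := fun k : ℕ => (k : ℝ) / n) (n := n) fun k _ => by
      rw [intervalIntegrable_iff_integrableOn_Ioc_of_le (hle k)]
      exact (integrable_const (g (k / n))).congr (hae k)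
  rw [show (0 : ℝ) = ((0 : ℕ) : ℝ) / n by simp, show (1 : ℝ) = (n : ℝ) / n by field_simp, ← h1,
    Finset.sum_div]
  refine Finset.sum_congr rfl fun k _ => ?_
  rw [intervalIntegral.integral_of_le (hle k), ← integral_congr_ae (hae k),
    ← intervalIntegral.integral_of_le (hle k), intervalIntegral.integral_const, smul_eq_mul]
  push_cast; field_simp; ring

end Grid

/-! ### Orthonormality of the sine modes, on the grid and on [0,1] -/

section Trig

/-- Telescoping of 2 sin(θ/2) cos(kθ) = sin(kθ + θ/2) - sin(kθ - θ/2). -/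
lemma sum_cos_nat_mul (θ : ℝ) (n : ℕ) :
    2 * Real.sin (θ / 2) * ∑ k ∈ Finset.range n, Real.cos (k * θ)
      = Real.sin (n * θ - θ / 2) + Real.sin (θ / 2) := by
  induction n with
  | zero => simp
  | succ n ih =>
    rw [Finset.sum_range_succ, mul_add, ih]
    rw [show ((n + 1 : ℕ) : ℝ) * θ - θ / 2 = n * θ + θ / 2 by push_cast; ring, Real.sin_sub,
      Real.sin_add]
    ring

lemma sum_cos_grid {n m : ℕ} (hm : 0 < m) (hmn : m < 2 * n) :
    ∑ k ∈ Finset.range n, Real.cos (k * (m * Real.pi / n)) = (1 - (-1) ^ m) / 2 := by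
  have hn : (0 : ℝ) < n := by
    have : 0 < n := by omega
    exact_mod_cast this
  have h := sum_cos_nat_mul (m * Real.pi / n) n
  rw [show (n : ℝ) * (m * Real.pi / n) = m * Real.pi by field_simp, Real.sin_sub,
    Real.sin_nat_mul_pi, Real.cos_nat_mul_pi] at h
  have hs : 0 < Real.sin (m * Real.pi / n / 2) := by
    have hm' : (m : ℝ) < 2 * n := by exact_mod_cast hmn
    refine Real.sin_pos_of_pos_of_lt_pi (by positivity) ?_
    rw [div_div, div_lt_iff₀ (by positivity)]
    nlinarith [Real.pi_pos]
  have h2 : 2 * Real.sin (m * Real.pi / n / 2) ≠ 0 := by positivity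
  apply mul_left_cancel₀ h2
  rw [h]; ring

/-- Product-to-sum turns this into two cosine sums of frequencies j - i and j + i < 2n. Off the
diagonal the frequencies have the same parity, so the sums are equal and cancel. On the diagonal,
frequency 0 contributes n and frequency 2i contributes 0. -/
lemma sum_sin_mul_sin_grid {n i j : ℕ} (hi : 1 ≤ i) (hin : i < n) (hj : 1 ≤ j) (hjn : j < n) :
    ∑ k ∈ Finset.range n, Real.sin (i * Real.pi * (k / n)) * Real.sin (j * Real.pi * (k / n))
      = if i = j then (n : ℝ) / 2 else 0 := by
  have key : ∀ i j : ℕ, 1 ≤ i → i < n → 1 ≤ j → j < n → i ≤ j →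
      ∑ k ∈ Finset.range n, Real.sin (i * Real.pi * (k / n)) * Real.sin (j * Real.pi * (k / n))
      = if i = j then (n : ℝ) / 2 else 0 := by
    intro i j hi hin hj hjn hij
    have e : ∀ k ∈ Finset.range n,
        Real.sin (i * Real.pi * (k / n)) * Real.sin (j * Real.pi * (k / n))
        = Real.cos (k * ((j - i : ℕ) * Real.pi / n)) / 2
          - Real.cos (k * ((j + i : ℕ) * Real.pi / n)) / 2 := by
      intro k _
      rw [show (k : ℝ) * ((j - i : ℕ) * Real.pi / n) = j * Real.pi * (k / n) - i * Real.pi * (k / n)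
          by push_cast [hij]; ring,
        show (k : ℝ) * ((j + i : ℕ) * Real.pi / n) = j * Real.pi * (k / n) + i * Real.pi * (k / n)
          by push_cast; ring, Real.cos_sub, Real.cos_add]
      ring
    rw [Finset.sum_congr rfl e, Finset.sum_sub_distrib, ← Finset.sum_div, ← Finset.sum_div,
      sum_cos_grid (m := j + i) (by omega) (by omega)]
    split_ifs with h
    · subst h
      have : (-1 : ℝ) ^ (i + i) = 1 := Even.neg_one_pow ⟨i, rfl⟩
      simp [this]
    · rw [sum_cos_grid (m := j - i) (by omega) (by omega)]
      have : (-1 : ℝ) ^ (j + i) = (-1) ^ (j - i) := by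
        rw [show j + i = (j - i) + 2 * i by omega, pow_add, pow_mul]; simp
      rw [this]; ring
  rcases le_total i j with h | h
  · exact key i j hi hin hj hjn h
  · have := key j i hj hjn hi hin h
    simp_rw [eq_comm (a := j) (b := i)] at this
    rw [← this]
    exact Finset.sum_congr rfl fun k _ => mul_comm _ _

lemma abs_phi_le (j : ℕ) (x : ℝ) : |phi j x| ≤ √2 := by
  rw [phi, abs_mul, abs_of_nonneg (Real.sqrt_nonneg 2)]
  exact mul_le_of_le_one_right (Real.sqrt_nonneg _) (Real.abs_sin_le_one _)

@[fun_prop]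
lemma continuous_phi (j : ℕ) : Continuous (phi j) := by unfold phi; fun_prop

lemma integral_phi_kappa_mul {n i j : ℕ} (hi : 1 ≤ i) (hin : i < n) (hj : 1 ≤ j) (hjn : j < n) :
    ∫ z, phi i (kappa n z) * phi j (kappa n z) ∂unitMeasure = if i = j then 1 else 0 := by
  have hn : 0 < n := by omega
  have h2 : √2 * √2 = (2 : ℝ) := Real.mul_self_sqrt (by norm_num)
  rw [integral_unitMeasure, integral_comp_kappa hn fun w => phi i w * phi j w]
  have : ∀ k ∈ Finset.range n, phi i (k / n) * phi j (k / n)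
      = 2 * (Real.sin (i * Real.pi * (k / n)) * Real.sin (j * Real.pi * (k / n))) := fun k _ => by
    unfold phi; linear_combination
      (Real.sin (i * Real.pi * (k / n)) * Real.sin (j * Real.pi * (k / n))) * h2
  rw [Finset.sum_congr rfl this, ← Finset.mul_sum, sum_sin_mul_sin_grid hi hin hj hjn]
  split_ifs
  · field_simp
  · simp

lemma tendsto_kappa (z : ℝ) : Tendsto (fun n : ℕ => kappa n z) atTop (𝓝 z) := by
  rw [tendsto_iff_norm_sub_tendsto_zero]
  refine squeeze_zero' (Eventually.of_forall fun n => norm_nonneg _) ?_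
    (tendsto_one_div_atTop_nhds_zero_nat (𝕜 := ℝ))
  filter_upwards [eventually_gt_atTop 0] with n hn using abs_kappa_sub_le hn z

lemma aestronglyMeasurable_comp_kappa {n : ℕ} (hn : 0 < n) {g : ℝ → ℝ}
    (hg : ContinuousOn g (Icc 0 1)) :
    AEStronglyMeasurable (fun z => g (kappa n z)) unitMeasure := by
  have hm := measurable_indicator_of_continuousOn hg measurableSet_Icc
  refine ((hm.comp (measurable_kappa n)).aestronglyMeasurable).congr ?_
  filter_upwards [ae_restrict_mem measurableSet_Icc] with z hz
  exact indicator_of_mem (kappa_mem hn hz) g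

lemma tendsto_integral_comp_kappa {g : ℝ → ℝ} (hg : ContinuousOn g (Icc 0 1)) :
    Tendsto (fun n : ℕ => ∫ z, g (kappa n z) ∂unitMeasure) atTop
      (𝓝 (∫ z, g z ∂unitMeasure)) := by
  obtain ⟨C, hC⟩ := isCompact_Icc.exists_bound_of_continuousOn hg
  refine tendsto_integral_filter_of_dominated_convergence (fun _ => C) ?_ ?_ (integrable_const C) ?_
  · filter_upwards [eventually_gt_atTop 0] with n hn
    exact aestronglyMeasurable_comp_kappa hn hg
  · filter_upwards [eventually_gt_atTop 0] with n hn
    filter_upwards [ae_restrict_mem measurableSet_Icc] with z hz using hC _ (kappa_mem hn hz)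
  · filter_upwards [ae_restrict_mem measurableSet_Icc] with z hz
    refine (hg z hz).tendsto.comp (tendsto_nhdsWithin_iff.2 ⟨tendsto_kappa z, ?_⟩)
    filter_upwards [eventually_gt_atTop 0] with n hn using kappa_mem hn hz

/-- The grid relations hold exactly for every n > max(i, j), and their left sides are Riemann sums
of this integral. -/
lemma integral_phi_mul {i j : ℕ} (hi : 1 ≤ i) (hj : 1 ≤ j) :
    ∫ z, phi i z * phi j z ∂unitMeasure = if i = j then 1 else 0 := by
  have h := tendsto_integral_comp_kappa (g := fun z => phi i z * phi j z) (by fun_prop)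
  refine tendsto_nhds_unique h (tendsto_const_nhds.congr' ?_)
  filter_upwards [eventually_gt_atTop (max i j)] with n hn
  exact (integral_phi_kappa_mul hi (by omega) hj (by omega)).symm

end Trig

lemma abs_sin_sub_sin_le (a b : ℝ) : |Real.sin a - Real.sin b| ≤ |a - b| := by
  simpa [Real.dist_eq] using (Real.lipschitzWith_sin.dist_le_mul a b)

lemma abs_cos_sub_cos_le (a b : ℝ) : |Real.cos a - Real.cos b| ≤ |a - b| := by
  simpa [Real.dist_eq] using (Real.lipschitzWith_cos.dist_le_mul a b)

lemma abs_phi_sub_le (j : ℕ) (x y : ℝ) : |phi j x - phi j y| ≤ √2 * (j * Real.pi) * |x - y| := by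
  rw [phi, phi, ← mul_sub, abs_mul, abs_of_nonneg (Real.sqrt_nonneg 2),
    mul_assoc √2]
  refine mul_le_mul_of_nonneg_left ?_ (Real.sqrt_nonneg 2)
  refine (abs_sin_sub_sin_le _ _).trans (le_of_eq ?_)
  rw [← mul_sub, abs_mul, abs_of_nonneg (by positivity)]

/-! ### Piecewise linear interpolation -/

section Interp

variable {n : ℕ}

lemma continuous_interp_aux (a : ℤ → ℝ) :
    Continuous fun y : ℝ => a ⌊y⌋ + (y - ⌊y⌋) * (a (⌊y⌋ + 1) - a ⌊y⌋) := by
  have hl : LocallyFinite fun k : ℤ => Icc (k : ℝ) (k + 1) :=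
    locallyFinite_Icc_of_tendsto tendsto_intCast_atTop_atTop
      (tendsto_atBot_add_const_right _ _ (tendsto_intCast_atBot_iff.2 tendsto_id))
  refine hl.continuous (iUnion_Icc_intCast ℝ) (fun _ => isClosed_Icc) fun k => ?_
  have hc : ContinuousOn (fun y : ℝ => a k + (y - k) * (a (k + 1) - a k)) (Icc (k : ℝ) (k + 1)) := by
    fun_prop
  refine hc.congr fun y hy => ?_
  rcases hy.2.lt_or_eq with h | h
  · have : ⌊y⌋ = k := Int.floor_eq_iff.2 ⟨hy.1, h⟩
    simp [this]
  -- At y = k + 1 the floor jumps, but both affine pieces take the value a (k + 1).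
  · simp [h]

lemma continuous_interp (n : ℕ) (w : ℝ → ℝ) : Continuous (interp n w) := by
  rcases Nat.eq_zero_or_pos n with rfl | hn
  -- For n = 0, division by zero makes κ_n vanish, and the interpolation weight is 0 as well.
  · have : interp 0 w = fun _ => w 0 := by ext x; simp [interp, kappa]
    rw [this]; exact continuous_const
  have h := (continuous_interp_aux fun k => w (k / n)).comp (continuous_const_mul (n : ℝ))
  convert h using 1
  ext x
  simp only [interp, kappa, Function.comp, mul_comm x]
  rw [← add_div]; push_cast; rfl

lemma interp_convex (n : ℕ) (w : ℝ → ℝ) (x : ℝ) : ∃ θ ∈ Icc (0 : ℝ) 1,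
    interp n w x = (1 - θ) * w (kappa n x) + θ * w (kappa n x + 1 / n) :=
  ⟨Int.fract (n * x), ⟨Int.fract_nonneg _, (Int.fract_lt_one _).le⟩, by
    rw [interp, Int.fract]; ring⟩

lemma abs_interp_le {w : ℝ → ℝ} {C : ℝ} (hw : ∀ x, |w x| ≤ C) (n : ℕ) (x : ℝ) :
    |interp n w x| ≤ C := by
  obtain ⟨θ, hθ, h⟩ := interp_convex n w x
  rw [h, abs_le]
  have h1 := abs_le.1 (hw (kappa n x))
  have h2 := abs_le.1 (hw (kappa n x + 1 / n))
  constructor <;> nlinarith [hθ.1, hθ.2]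

lemma abs_interp_sub_le (hn : 0 < n) {w : ℝ → ℝ} {C : ℝ} (hC : 0 ≤ C)
    (hw : ∀ x y, |w x - w y| ≤ C * |x - y|) (x : ℝ) : |interp n w x - w x| ≤ C / n := by
  obtain ⟨θ, hθ, h⟩ := interp_convex n w x
  have h0 : (0 : ℝ) ≤ 1 / n := by positivity
  have h1 : |w (kappa n x) - w x| ≤ C / n := (hw _ _).trans (by
    rw [div_eq_mul_one_div C]; gcongr; exact abs_kappa_sub_le hn x)
  have h2 : |w (kappa n x + 1 / n) - w x| ≤ C / n := (hw _ _).trans (by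
    rw [div_eq_mul_one_div C]; gcongr
    rw [abs_le]; constructor <;> linarith [kappa_le hn x, lt_kappa_add hn x])
  rw [h, abs_le]
  rw [abs_le] at h1 h2
  constructor <;> nlinarith [hθ.1, hθ.2]

end Interp

/-! ### Coefficients of the two Green functions and their convergence -/

section Coeff

/-- The coefficient of `φ_j` in the Green function. -/
def waveCoeff (j : ℕ) (t x : ℝ) : ℝ := Real.sin (j * Real.pi * t) / (j * Real.pi) * phi j x

/-- The coefficient of `φ_j ∘ κ_n` in the discrete Green function. -/
def discWaveCoeff (n j : ℕ) (t x : ℝ) : ℝ :=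
  Real.sin (j * Real.pi * t * √(discCoeff n j)) / (j * Real.pi * √(discCoeff n j))
    * interp n (phi j) x

lemma sqrt_discCoeff (n j : ℕ) : √(discCoeff n j)
    = |Real.sin (j / (2 * n) * Real.pi) / (j / (2 * n) * Real.pi)| := by
  rw [discCoeff, ← div_pow, Real.sqrt_sq_eq_abs]

/-- Jordan's inequality sin x ≥ 2x/π at x = jπ/(2n) ≤ π/2. It serves twice: the discrete wave speeds
stay away from 0, and the eigenvalues of the discrete Laplacian are bounded below. -/
lemma div_le_sin_grid {n j : ℕ} (hjn : j ≤ n) :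
    (j : ℝ) / n ≤ Real.sin (j / (2 * n) * Real.pi) := by
  rcases Nat.eq_zero_or_pos n with rfl | hn
  · simp
  have hn' : (0 : ℝ) < n := by exact_mod_cast hn
  have hjn' : (j : ℝ) ≤ n := by exact_mod_cast hjn
  refine le_trans (le_of_eq ?_) (Real.mul_le_sin (x := j / (2 * n) * Real.pi) (by positivity) ?_)
  · have := Real.pi_ne_zero
    field_simp
  · rw [div_mul_eq_mul_div, div_le_div_iff₀ (by positivity) (by norm_num)]
    nlinarith [Real.pi_pos]

lemma two_div_pi_le_sqrt_discCoeff {n j : ℕ} (hj : 1 ≤ j) (hjn : j ≤ n) :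
    2 / Real.pi ≤ √(discCoeff n j) := by
  have hn : (0 : ℝ) < n := by
    have : 0 < n := by omega
    exact_mod_cast this
  have hj' : (0 : ℝ) < j := by exact_mod_cast hj
  have hpi := Real.pi_pos
  rw [sqrt_discCoeff]
  refine le_trans ?_ (le_abs_self _)
  rw [le_div_iff₀ (by positivity)]
  refine le_trans (le_of_eq ?_) (div_le_sin_grid hjn)
  field_simp

/-- √c_j^n is |sinc(jπ/(2n))|, and sinc is continuous with value 1 at 0. -/
lemma tendsto_sqrt_discCoeff {j : ℕ} (hj : 1 ≤ j) :
    Tendsto (fun n : ℕ => √(discCoeff n j)) atTop (𝓝 1) := by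
  have h1 : Tendsto (fun n : ℕ => (j : ℝ) / (2 * n) * Real.pi) atTop (𝓝 0) := by
    have := (tendsto_one_div_atTop_nhds_zero_nat (𝕜 := ℝ)).const_mul (j / 2 * Real.pi)
    rw [mul_zero] at this
    refine this.congr fun n => ?_
    rw [mul_one_div, mul_div_right_comm, div_div]
  have h2 := (Real.continuous_sinc.tendsto 0).comp h1
  have h3 := h2.abs
  rw [Real.sinc_zero, abs_one] at h3
  refine h3.congr' ?_
  filter_upwards [eventually_gt_atTop 0] with n hn
  have hj' : (0 : ℝ) < j := by exact_mod_cast hj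
  have hn' : (0 : ℝ) < n := by exact_mod_cast hn
  rw [Function.comp, Real.sinc_of_ne_zero (by have := Real.pi_pos; positivity), sqrt_discCoeff]

lemma sqrt_two_le_pi : √2 ≤ Real.pi := by
  have := Real.pi_gt_three
  rw [Real.sqrt_le_left (by linarith)]; nlinarith

lemma sqrt_two_le_two : √2 ≤ (2 : ℝ) := by
  rw [Real.sqrt_le_left (by norm_num)]; norm_num

lemma abs_waveCoeff_le (j : ℕ) (t x : ℝ) : |waveCoeff j t x| ≤ 1 / j := by
  rcases Nat.eq_zero_or_pos j with rfl | hj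
  · simp [waveCoeff]
  have hj' : (0 : ℝ) < j := by exact_mod_cast hj
  have hpi := Real.pi_pos
  rw [waveCoeff, abs_mul, abs_div, abs_of_pos (show 0 < j * Real.pi by positivity)]
  calc _ ≤ 1 / (j * Real.pi) * √2 := by
        gcongr
        · exact Real.abs_sin_le_one _
        · exact abs_phi_le _ _
    _ ≤ 1 / (j * Real.pi) * Real.pi := by gcongr; exact sqrt_two_le_pi
    _ = 1 / j := by field_simp

lemma abs_discWaveCoeff_le {n j : ℕ} (hjn : j ≤ n) (t x : ℝ) :
    |discWaveCoeff n j t x| ≤ 1 / j := by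
  rcases Nat.eq_zero_or_pos j with rfl | hj
  · simp [discWaveCoeff]
  have hj' : (0 : ℝ) < j := by exact_mod_cast hj
  have hpi := Real.pi_pos
  have hs := two_div_pi_le_sqrt_discCoeff hj hjn
  rw [discWaveCoeff, abs_mul, abs_div, abs_of_nonneg (show 0 ≤ j * Real.pi * √(discCoeff n j) by
    positivity)]
  calc _ ≤ 1 / (j * Real.pi * (2 / Real.pi)) * √2 := by
        gcongr
        · exact Real.abs_sin_le_one _
        · exact abs_interp_le (abs_phi_le j) _ _
    _ ≤ 1 / (j * Real.pi * (2 / Real.pi)) * 2 := by gcongr; exact sqrt_two_le_two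
    _ = 1 / j := by field_simp

/-- A bound for `|discWaveCoeff n j t x - waveCoeff j t x|` that vanishes as `n → ∞`. -/
lemma exists_discWaveCoeff_sub_le (T : ℝ) (j : ℕ) : ∃ β : ℕ → ℝ, Tendsto β atTop (𝓝 0) ∧
    ∀ᶠ n in atTop, ∀ t ∈ Icc 0 T, ∀ x, |discWaveCoeff n j t x - waveCoeff j t x| ≤ β n := by
  rcases Nat.eq_zero_or_pos j with rfl | hj
  · exact ⟨fun _ => 0, tendsto_const_nhds, Eventually.of_forall fun n t _ x => by
      simp [discWaveCoeff, waveCoeff]⟩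
  have hj' : (0 : ℝ) < j := by exact_mod_cast hj
  have hpi := Real.pi_pos
  set s : ℕ → ℝ := fun n => √(discCoeff n j) with hs
  have hs1 : Tendsto s atTop (𝓝 1) := tendsto_sqrt_discCoeff hj
  refine ⟨fun n => (T * |s n - 1| * |(s n)⁻¹| + 1 / (j * Real.pi) * |(s n)⁻¹ - 1|) * √2
      + 1 / (j * Real.pi) * (√2 * (j * Real.pi) / n), ?_, ?_⟩
  · have h1 : Tendsto (fun n => |s n - 1|) atTop (𝓝 0) := by
      simpa using (hs1.sub_const 1).abs
    have h2 : Tendsto (fun n => (s n)⁻¹) atTop (𝓝 1) := by simpa using hs1.inv₀ one_ne_zero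
    have h3 : Tendsto (fun n => |(s n)⁻¹ - 1|) atTop (𝓝 0) := by
      simpa using (h2.sub_const 1).abs
    have h4 := tendsto_const_div_atTop_nhds_zero_nat (√2 * (j * Real.pi))
    simpa using ((((h1.const_mul T).mul h2.abs).add (h3.const_mul (1 / (j * Real.pi)))).mul_const
      √2).add (h4.const_mul (1 / (j * Real.pi)))
  · filter_upwards [eventually_gt_atTop 0] with n hn t ht x
    have hT0 : 0 ≤ T := ht.1.trans ht.2
    have hA1 : |Real.sin (j * Real.pi * t) / (j * Real.pi)| ≤ 1 / (j * Real.pi) := by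
      rw [abs_div, abs_of_pos (show 0 < j * Real.pi by positivity)]
      gcongr; exact Real.abs_sin_le_one _
    have hd : |Real.sin (j * Real.pi * t * s n) / (j * Real.pi)
        - Real.sin (j * Real.pi * t) / (j * Real.pi)| ≤ T * |s n - 1| := by
      rw [← sub_div, abs_div, abs_of_pos (show 0 < j * Real.pi by positivity),
        div_le_iff₀ (by positivity)]
      refine (abs_sin_sub_sin_le _ _).trans ?_
      rw [show j * Real.pi * t * s n - j * Real.pi * t = (j * Real.pi * t) * (s n - 1) by ring,
        abs_mul, abs_of_nonneg (show 0 ≤ j * Real.pi * t by have := ht.1; positivity)]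
      nlinarith [mul_le_mul_of_nonneg_right ht.2
        (show 0 ≤ j * Real.pi * |s n - 1| by positivity)]
    -- Three errors are separated: the frequency inside the sine, the factor 1/√c_j^n, and the
    -- interpolation of φ_j.
    have e : discWaveCoeff n j t x - waveCoeff j t x
        = ((Real.sin (j * Real.pi * t * s n) / (j * Real.pi)
            - Real.sin (j * Real.pi * t) / (j * Real.pi)) * (s n)⁻¹
          + Real.sin (j * Real.pi * t) / (j * Real.pi) * ((s n)⁻¹ - 1)) * interp n (phi j) x
          + Real.sin (j * Real.pi * t) / (j * Real.pi) * (interp n (phi j) x - phi j x) := by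
      rw [discWaveCoeff, waveCoeff, ← div_div]; ring
    rw [e]
    refine (abs_add_le _ _).trans (add_le_add ?_ ?_)
    · rw [abs_mul]
      gcongr
      · refine (abs_add_le _ _).trans ?_
        rw [abs_mul, abs_mul]
        gcongr
      · exact abs_interp_le (abs_phi_le j) _ _
    · rw [abs_mul]
      gcongr
      exact abs_interp_sub_le hn (by positivity) (abs_phi_sub_le j) x

/-- A bound for the difference of the coefficients of the initial position that vanishes as
`n → ∞`. -/
lemma exists_cos_interp_sub_le (T : ℝ) {j : ℕ} (hj : 1 ≤ j) : ∃ β : ℕ → ℝ,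
    Tendsto β atTop (𝓝 0) ∧ ∀ᶠ n in atTop, ∀ t ∈ Icc 0 T, ∀ x,
      |Real.cos (j * Real.pi * t * √(discCoeff n j)) * interp n (phi j) x
        - Real.cos (j * Real.pi * t) * phi j x| ≤ β n := by
  have hpi := Real.pi_pos
  set s : ℕ → ℝ := fun n => √(discCoeff n j) with hs
  have hs1 : Tendsto s atTop (𝓝 1) := tendsto_sqrt_discCoeff hj
  refine ⟨fun n => j * Real.pi * T * |s n - 1| * √2 + √2 * (j * Real.pi) / n, ?_, ?_⟩
  · have h1 : Tendsto (fun n => |s n - 1|) atTop (𝓝 0) := by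
      simpa using (hs1.sub_const 1).abs
    have h4 := tendsto_const_div_atTop_nhds_zero_nat (√2 * (j * Real.pi))
    simpa using ((h1.const_mul (j * Real.pi * T)).mul_const √2).add h4
  · filter_upwards [eventually_gt_atTop 0] with n hn t ht x
    have hT0 : 0 ≤ T := ht.1.trans ht.2
    have e : Real.cos (j * Real.pi * t * s n) * interp n (phi j) x
        - Real.cos (j * Real.pi * t) * phi j x
        = (Real.cos (j * Real.pi * t * s n) - Real.cos (j * Real.pi * t)) * interp n (phi j) x
          + Real.cos (j * Real.pi * t) * (interp n (phi j) x - phi j x) := by ring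
    rw [e]
    refine (abs_add_le _ _).trans (add_le_add ?_ ?_)
    · rw [abs_mul]
      gcongr
      · refine (abs_cos_sub_cos_le _ _).trans ?_
        rw [show j * Real.pi * t * s n - j * Real.pi * t = (j * Real.pi * t) * (s n - 1) by ring,
          abs_mul, abs_of_nonneg (show 0 ≤ j * Real.pi * t by have := ht.1; positivity)]
        gcongr
        exact ht.2
      · exact abs_interp_le (abs_phi_le j) _ _
    · rw [abs_mul]
      calc _ ≤ 1 * (√2 * (j * Real.pi) / n) := by
            gcongr
            · exact Real.abs_cos_le_one _
            · exact abs_interp_sub_le hn (by positivity) (abs_phi_sub_le j) x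
        _ = _ := one_mul _

end Coeff

/-! ### Decay of the discrete sine coefficients -/

section SummationByParts

/-- Self-adjointness of the discrete Dirichlet Laplacian. The difference of the summands telescopes
to the discrete Wronskian p_m u_{m+1} - u_m p_{m+1}, which vanishes at both ends. -/
lemma sum_mul_second_difference (p u : ℕ → ℝ) (m : ℕ) (hp0 : p 0 = 0) (hu0 : u 0 = 0)
    (hp : p (m + 1) = 0) (hu : u (m + 1) = 0) :
    ∑ k ∈ Finset.range m, p (k + 1) * (u (k + 2) + u k - 2 * u (k + 1))
      = ∑ k ∈ Finset.range m, u (k + 1) * (p (k + 2) + p k - 2 * p (k + 1)) := by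
  have h : ∀ m : ℕ, ∑ k ∈ Finset.range m, (p (k + 1) * (u (k + 2) + u k - 2 * u (k + 1))
      - u (k + 1) * (p (k + 2) + p k - 2 * p (k + 1)))
      = p m * u (m + 1) - u m * p (m + 1) - (p 0 * u 1 - u 0 * p 1) := by
    intro m
    induction m with
    | zero => simp
    | succ m ih => rw [Finset.sum_range_succ, ih]; ring
  rw [← sub_eq_zero, ← Finset.sum_sub_distrib, h, hp0, hu0, hp, hu]
  ring

/-- The mean value inequality is applied twice: u' is C-Lipschitz with C a bound for |u''|, so y ↦
u(y + h) - u(y) has derivative at most Ch and varies by at most Ch² over [x, x + h]. -/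
lemma exists_second_difference_le {u : ℝ → ℝ} (hu : ContDiffOn ℝ 2 u (Icc 0 1)) :
    ∃ D, 0 ≤ D ∧ ∀ x h : ℝ, 0 ≤ h → 0 ≤ x → x + 2 * h ≤ 1 →
      |u (x + 2 * h) + u x - 2 * u (x + h)| ≤ D * h ^ 2 := by
  have huniq := uniqueDiffOn_Icc (zero_lt_one' ℝ)
  have hu1 : ContDiffOn ℝ 1 (derivWithin u (Icc 0 1)) (Icc 0 1) :=
    hu.derivWithin huniq (by norm_num)
  have hu2 : ContinuousOn (derivWithin (derivWithin u (Icc 0 1)) (Icc 0 1)) (Icc 0 1) :=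
    hu1.continuousOn_derivWithin huniq (by norm_num)
  obtain ⟨C, hC⟩ := isCompact_Icc.exists_bound_of_continuousOn hu2
  have hC0 : 0 ≤ C := (norm_nonneg _).trans (hC 0 (by simp))
  refine ⟨C, hC0, fun x h hh hx hxh => ?_⟩
  have hlip : ∀ y ∈ Icc (0 : ℝ) 1, ∀ z ∈ Icc (0 : ℝ) 1,
      ‖derivWithin u (Icc 0 1) z - derivWithin u (Icc 0 1) y‖ ≤ C * ‖z - y‖ := fun y hy z hz =>
    (convex_Icc 0 1).norm_image_sub_le_of_norm_derivWithin_le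
      (hu1.differentiableOn one_ne_zero) hC hy hz
  have hdiff := hu.differentiableOn two_ne_zero
  have hmaps : ∀ c : ℝ, 0 ≤ c → c ≤ h → MapsTo (fun y => y + c) (Icc x (x + h)) (Icc (0 : ℝ) 1) :=
    fun c hc hch y hy => ⟨by have := hy.1; simp only; linarith, by have := hy.2; simp only; linarith⟩
  have hd : ∀ c : ℝ, 0 ≤ c → c ≤ h → ∀ y ∈ Icc x (x + h),
      HasDerivWithinAt (fun y => u (y + c)) (derivWithin u (Icc 0 1) (y + c)) (Icc x (x + h)) y := by
    intro c hc hch y hy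
    have h1 := (hdiff _ (hmaps c hc hch hy)).hasDerivWithinAt
    have h2 := h1.comp y ((hasDerivWithinAt_id y (Icc x (x + h))).add_const c) (hmaps c hc hch)
    rw [mul_one] at h2
    exact h2
  have key := (convex_Icc x (x + h)).norm_image_sub_le_of_norm_hasDerivWithin_le
    (f := fun y => u (y + h) - u (y + 0)) (C := C * h)
    (fun y hy => (hd h hh le_rfl y hy).sub (hd 0 le_rfl hh y hy)) (fun y hy => by
      have := hlip _ (hmaps 0 le_rfl hh hy) _ (hmaps h hh le_rfl hy)
      rw [show y + h - (y + 0) = h by ring, Real.norm_of_nonneg hh] at this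
      exact this)
    (left_mem_Icc.2 (by linarith)) (right_mem_Icc.2 (by linarith))
  rw [Real.norm_eq_abs] at key
  simp only [add_zero] at key
  rw [show u (x + 2 * h) + u x - 2 * u (x + h)
    = u (x + h + h) - u (x + h) - (u (x + h) - u x) by
      rw [show x + 2 * h = x + h + h by ring]; ring]
  refine key.trans (le_of_eq ?_)
  rw [add_sub_cancel_left, Real.norm_of_nonneg hh]; ring

/-- The discrete sine coefficients of the initial position decay quadratically. -/
lemma exists_abs_integral_phi_kappa_le {u : ℝ → ℝ} (hu : ContDiffOn ℝ 2 u (Icc 0 1)) (hu0 : u 0 = 0)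
    (hu1 : u 1 = 0) : ∃ D, 0 ≤ D ∧ ∀ n j : ℕ, 1 ≤ j → j < n →
      |∫ z, phi j (kappa n z) * u (kappa n z) ∂unitMeasure| ≤ D * (1 / (j : ℝ) ^ 2) := by
  obtain ⟨D, hD0, hD⟩ := exists_second_difference_le hu
  refine ⟨D, hD0, fun n j hj hjn => ?_⟩
  obtain ⟨m, hn⟩ : ∃ m, n = m + 1 := ⟨n - 1, by omega⟩
  have hn0 : (0 : ℝ) < n := by rw [hn]; positivity
  have hj0 : (0 : ℝ) < j := by exact_mod_cast hj
  set p : ℕ → ℝ := fun k => phi j (k / n) with hp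
  set w : ℕ → ℝ := fun k => u (k / n) with hw
  set S := ∑ k ∈ Finset.range m, p (k + 1) * w (k + 1) with hS
  have hp0 : p 0 = 0 := by simp [hp, phi]
  have hw0 : w 0 = 0 := by simp [hw, hu0]
  have hpn : p n = 0 := by simp [hp, phi, div_self hn0.ne', Real.sin_nat_mul_pi]
  have hwn : w n = 0 := by simp [hw, hu1, div_self hn0.ne']
  have hsum : ∑ k ∈ Finset.range n, p k * w k = S := by
    rw [congrArg Finset.range hn, Finset.sum_range_succ', hp0, zero_mul, add_zero]
  -- The grid values of φ_j are an eigenvector of the second difference operator.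
  have hlap : ∀ k, p (k + 2) + p k - 2 * p (k + 1)
      = -(4 * Real.sin (j / (2 * n) * Real.pi) ^ 2) * p (k + 1) := by
    intro k
    have e1 : (j : ℝ) * Real.pi * ((k + 2 : ℕ) / n)
        = j * Real.pi * ((k + 1 : ℕ) / n) + 2 * (j / (2 * n) * Real.pi) := by
      push_cast; field_simp; ring
    have e2 : (j : ℝ) * Real.pi * (k / n)
        = j * Real.pi * ((k + 1 : ℕ) / n) - 2 * (j / (2 * n) * Real.pi) := by
      push_cast; field_simp; ring
    simp only [hp, phi]
    rw [e1, e2, Real.sin_add, Real.sin_sub, Real.cos_two_mul, Real.cos_sq']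
    ring
  have hparts := sum_mul_second_difference p w m hp0 hw0 (hn ▸ hpn) (hn ▸ hwn)
  have hR : ∑ k ∈ Finset.range m, w (k + 1) * (p (k + 2) + p k - 2 * p (k + 1))
      = -(4 * Real.sin (j / (2 * n) * Real.pi) ^ 2) * S := by
    rw [hS, Finset.mul_sum]
    exact Finset.sum_congr rfl fun k _ => by rw [hlap]; ring
  have hL : |∑ k ∈ Finset.range m, p (k + 1) * (w (k + 2) + w k - 2 * w (k + 1))|
      ≤ 2 * D / n := by
    refine (Finset.abs_sum_le_sum_abs _ _).trans ?_
    calc _ ≤ ∑ k ∈ Finset.range m, 2 * (D * (1 / (n : ℝ)) ^ 2) := by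
          refine Finset.sum_le_sum fun k hk => ?_
          rw [abs_mul]
          have hk' : k + 2 ≤ n := by have := Finset.mem_range.1 hk; omega
          have hk'' : (k : ℝ) + 2 ≤ n := by exact_mod_cast hk'
          have h2 := hD (k / n) (1 / n) (by positivity) (by positivity) (by
            rw [mul_one_div, ← add_div, div_le_one hn0]; exact hk'')
          rw [mul_one_div, ← add_div, ← add_div] at h2
          have h1 : |p (k + 1)| ≤ 2 := (abs_phi_le _ _).trans sqrt_two_le_two
          refine mul_le_mul h1 (le_trans (le_of_eq ?_) h2) (abs_nonneg _) (by norm_num)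
          simp only [hw]; push_cast; rfl
      _ = (m : ℝ) * (2 * (D * (1 / (n : ℝ)) ^ 2)) := by simp
      _ ≤ n * (2 * (D * (1 / (n : ℝ)) ^ 2)) := by
          gcongr; omega
      _ = _ := by field_simp
  rw [hparts, hR, abs_mul, abs_neg, abs_of_nonneg (by positivity)] at hL
  have hsin := div_le_sin_grid hjn.le
  -- The eigenvalue 4 sin²(jπ/(2n)) is at least 4(j/n)². Dividing by it leaves |S|/n ≤ D/(2j²), free
  -- of n.
  have h4 : 4 * ((j : ℝ) / n) ^ 2 * |S| ≤ 2 * D / n := by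
    have hsq := pow_le_pow_left₀ (show (0 : ℝ) ≤ j / n by positivity) hsin 2
    exact (mul_le_mul_of_nonneg_right (by linarith) (abs_nonneg S)).trans hL
  have hint : ∫ z, phi j (kappa n z) * u (kappa n z) ∂unitMeasure = S / n := by
    rw [integral_unitMeasure, integral_comp_kappa (by omega) fun z => phi j z * u z, ← hsum]
  rw [hint, abs_div, abs_of_pos hn0, div_le_iff₀ hn0]
  have h5 : 4 * ((j : ℝ) / n) ^ 2 * |S| * n ^ 2 = 4 * j ^ 2 * |S| := by
    rw [div_pow]; field_simp
  have h6 : 4 * (j : ℝ) ^ 2 * |S| ≤ 2 * D * n := by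
    rw [← h5]; refine (mul_le_mul_of_nonneg_right h4 (by positivity)).trans (le_of_eq ?_)
    field_simp
  rw [mul_one_div, div_mul_eq_mul_div, le_div_iff₀ (by positivity)]
  nlinarith [abs_nonneg S, mul_nonneg hD0 hn0.le]

end SummationByParts

/-! ### L² bounds, convergence and continuity of the Green functions -/

lemma HasL2Bound.of_tendsto {α : Type*} [MeasurableSpace α] {μ : Measure α} {f : ℕ → α → ℝ}
    {g : α → ℝ} {A : ℝ} (hf : ∀ᶠ N in atTop, HasL2Bound μ (f N) A)
    (hm : ∀ N, AEStronglyMeasurable (f N) μ)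
    (h : ∀ x, Tendsto (fun N => f N x) atTop (𝓝 (g x))) : HasL2Bound μ g A := by
  obtain ⟨N, hN⟩ := hf.exists
  refine ⟨aestronglyMeasurable_of_tendsto_ae atTop hm (ae_of_all _ h), hN.nonneg, ?_⟩
  refine (Lp.eLpNorm_lim_le_liminf_eLpNorm hm g (ae_of_all _ h)).trans ?_
  refine Filter.liminf_le_of_frequently_le' (Eventually.frequently ?_)
  filter_upwards [hf] with N hN using hN.le

lemma greenPartial_eq_sum (N : ℕ) (t x z : ℝ) :
    greenPartial N t x z = ∑ j ∈ Finset.Icc 1 N, waveCoeff j t x * phi j z := rfl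

lemma discGreen_eq_sum (n : ℕ) (t x z : ℝ) :
    discGreen n t x z
      = ∑ j ∈ Finset.Icc 1 (n - 1), discWaveCoeff n j t x * phi j (kappa n z) := rfl

lemma tendsto_greenPartial (t x z : ℝ) :
    Tendsto (fun N => greenPartial N t x z) atTop (𝓝 (green t x z)) :=
  tendsto_nhds_limUnder (exists_tendsto_greenPartial t x z)

lemma green_zero (x z : ℝ) : green 0 x z = 0 :=
  tendsto_nhds_unique (tendsto_greenPartial 0 x z)
    (tendsto_const_nhds.congr fun N => by simp [greenPartial])

lemma discGreen_zero (n : ℕ) (x z : ℝ) : discGreen n 0 x z = 0 := by simp [discGreen]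

lemma continuous_greenPartial (N : ℕ) :
    Continuous fun q : ℝ × ℝ × ℝ => greenPartial N q.1 q.2.1 q.2.2 := by
  unfold greenPartial; fun_prop

lemma measurable_green : Measurable fun q : ℝ × ℝ × ℝ => green q.1 q.2.1 q.2.2 := by
  have h : Tendsto (fun (N : ℕ) (q : ℝ × ℝ × ℝ) => greenPartial N q.1 q.2.1 q.2.2) atTop
      (𝓝 fun q : ℝ × ℝ × ℝ => green q.1 q.2.1 q.2.2) := by
    rw [tendsto_pi_nhds]
    intro q
    exact tendsto_greenPartial q.1 q.2.1 q.2.2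
  exact measurable_of_tendsto_metrizable (fun N => (continuous_greenPartial N).measurable) h

lemma continuous_discWaveCoeff (n j : ℕ) :
    Continuous fun q : ℝ × ℝ => discWaveCoeff n j q.1 q.2 := by
  have := continuous_interp n (phi j)
  unfold discWaveCoeff; fun_prop

lemma measurable_discGreen (n : ℕ) :
    Measurable fun q : ℝ × ℝ × ℝ => discGreen n q.1 q.2.1 q.2.2 := by
  simp_rw [discGreen_eq_sum]
  have hA : ∀ j, Measurable fun q : ℝ × ℝ × ℝ => discWaveCoeff n j q.1 q.2.1 := fun j => by
    have := continuous_interp n (phi j)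
    refine Continuous.measurable ?_
    unfold discWaveCoeff; fun_prop
  have hB : ∀ j, Measurable fun q : ℝ × ℝ × ℝ => phi j (kappa n q.2.2) := fun j =>
    (continuous_phi j).measurable.comp
      ((measurable_kappa n).comp (measurable_snd.comp measurable_snd))
  exact Finset.measurable_fun_sum _ fun j _ => (hA j).mul (hB j)

lemma abs_discGreen_le (n : ℕ) (t x z : ℝ) :
    |discGreen n t x z| ≤ ∑ j ∈ Finset.Icc 1 (n - 1), 1 / (j : ℝ) * √2 := by
  rw [discGreen_eq_sum]
  refine (Finset.abs_sum_le_sum_abs _ _).trans (Finset.sum_le_sum fun j hj => ?_)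
  rw [abs_mul]
  have := Finset.mem_Icc.1 hj
  gcongr
  · exact abs_discWaveCoeff_le (by omega) _ _
  · exact abs_phi_le _ _

lemma memLp_phi (j : ℕ) : MemLp (phi j) 2 unitMeasure :=
  (HasL2Bound.of_abs_le_unit (Real.sqrt_nonneg 2) (continuous_phi j).aestronglyMeasurable
    fun _ _ => abs_phi_le j _).memLp

lemma memLp_phi_kappa (n j : ℕ) : MemLp (fun z => phi j (kappa n z)) 2 unitMeasure :=
  (HasL2Bound.of_abs_le_unit (Real.sqrt_nonneg 2)
    ((continuous_phi j).measurable.comp (measurable_kappa n)).aestronglyMeasurable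
    fun _ _ => abs_phi_le j _).memLp

/-- The sum of 1/j² over J < j ≤ N is at most 1/J - 1/N. This is the source of the tail rate 1/√J.
-/
lemma sum_sq_tail_le {c : ℕ → ℝ} {J N : ℕ} (hJ : 1 ≤ J)
    (hc : ∀ j ∈ Finset.Ioc J N, |c j| ≤ 1 / j) :
    ∑ j ∈ Finset.Ioc J N, c j ^ 2 ≤ (1 / √J) ^ 2 := by
  rcases le_total N J with h | h
  · rw [Finset.Ioc_eq_empty (by omega)]; simp
  calc _ ≤ ∑ j ∈ Finset.Ioc J N, ((j : ℝ) ^ 2)⁻¹ := by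
        refine Finset.sum_le_sum fun j hj => ?_
        rw [← sq_abs]
        refine (pow_le_pow_left₀ (abs_nonneg _) (hc j hj) 2).trans (le_of_eq ?_)
        rw [div_pow, one_pow, one_div]
    _ ≤ (J : ℝ)⁻¹ - (N : ℝ)⁻¹ := sum_Ioc_inv_sq_le_sub (by omega) h
    _ ≤ (J : ℝ)⁻¹ := by have : (0 : ℝ) ≤ (N : ℝ)⁻¹ := by positivity
                        linarith
    _ = _ := by rw [div_pow, one_pow, Real.sq_sqrt (by positivity), one_div]

lemma sum_sq_le {c : ℕ → ℝ} {N : ℕ} (hc : ∀ j ∈ Finset.Icc 1 N, |c j| ≤ 1 / j) :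
    ∑ j ∈ Finset.Icc 1 N, c j ^ 2 ≤ 2 ^ 2 := by
  rcases Nat.eq_zero_or_pos N with rfl | hN
  · simp
  rw [← Finset.add_sum_Ioc_eq_sum_Icc (show 1 ≤ N from hN)]
  have h1 := hc 1 (Finset.mem_Icc.2 ⟨le_rfl, hN⟩)
  have h2 := sum_sq_tail_le (c := c) (J := 1) (N := N) le_rfl fun j hj => hc j (by
    have := Finset.mem_Ioc.1 hj
    exact Finset.mem_Icc.2 ⟨by omega, by omega⟩)
  rw [← sq_abs]
  simp only [Nat.cast_one, div_one, Real.sqrt_one] at h1 h2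
  nlinarith [abs_nonneg (c 1)]

lemma hasL2Bound_greenPartial (N : ℕ) (t x : ℝ) :
    HasL2Bound unitMeasure (greenPartial N t x) 2 :=
  hasL2Bound_sum_of_orthonormal _ phi _ (fun j _ => memLp_phi j)
    (fun _ hi _ hj => integral_phi_mul (Finset.mem_Icc.1 hi).1 (Finset.mem_Icc.1 hj).1)
    (by norm_num) (sum_sq_le fun j _ => abs_waveCoeff_le j t x)

/-- The partial sums converge at every point, so Fatou's lemma carries their uniform Parseval bound
over to the limit. -/
lemma hasL2Bound_green (t x : ℝ) : HasL2Bound unitMeasure (green t x) 2 :=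
  .of_tendsto (Eventually.of_forall fun N => hasL2Bound_greenPartial N t x)
    (fun N => (hasL2Bound_greenPartial N t x).aesm) fun z => tendsto_greenPartial t x z

lemma hasL2Bound_discGreen (n : ℕ) (t x : ℝ) :
    HasL2Bound unitMeasure (discGreen n t x) 2 := by
  refine hasL2Bound_sum_of_orthonormal _ (fun j z => phi j (kappa n z)) _
    (fun j _ => memLp_phi_kappa n j) (fun i hi j hj => ?_) (by norm_num)
    (sum_sq_le fun j hj => abs_discWaveCoeff_le ?_ t x)
  · have h1 := Finset.mem_Icc.1 hi
    have h2 := Finset.mem_Icc.1 hj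
    exact integral_phi_kappa_mul h1.1 (by omega) h2.1 (by omega)
  · have := Finset.mem_Icc.1 hj
    omega

lemma sum_Icc_eq_add_sum_Ioc (f : ℕ → ℝ) {J N : ℕ} (h : J ≤ N) :
    ∑ j ∈ Finset.Icc 1 N, f j = ∑ j ∈ Finset.Icc 1 J, f j + ∑ j ∈ Finset.Ioc J N, f j := by
  have h1 : ∀ M, Finset.Icc 1 M = Finset.Ioc 0 M := fun M => by ext; simp; omega
  rw [h1, h1, Finset.sum_Ioc_consecutive _ (Nat.zero_le J) h]

lemma hasL2Bound_green_sub_greenPartial {J : ℕ} (hJ : 1 ≤ J) (t x : ℝ) :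
    HasL2Bound unitMeasure (fun z => green t x z - greenPartial J t x z) (1 / √J) := by
  refine .of_tendsto (f := fun N z => greenPartial N t x z - greenPartial J t x z) ?_
    (fun N => (hasL2Bound_greenPartial N t x).aesm.sub (hasL2Bound_greenPartial J t x).aesm)
    fun z => (tendsto_greenPartial t x z).sub_const _
  filter_upwards [eventually_ge_atTop J] with N hN
  have := hasL2Bound_sum_of_orthonormal (μ := unitMeasure) (Finset.Ioc J N) phi
    (fun j => waveCoeff j t x) (fun j _ => memLp_phi j)
    (fun i hi j hj => integral_phi_mul (by have := Finset.mem_Ioc.1 hi; omega)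
      (by have := Finset.mem_Ioc.1 hj; omega))
    (by positivity) (sum_sq_tail_le hJ fun j _ => abs_waveCoeff_le j t x)
  refine this.congr (ae_of_all _ fun z => ?_)
  simp only [greenPartial_eq_sum]
  rw [sum_Icc_eq_add_sum_Ioc (fun j => waveCoeff j t x * phi j z) hN]; ring

lemma hasL2Bound_discGreen_tail {J : ℕ} (hJ : 1 ≤ J) (n : ℕ) (t x : ℝ) :
    HasL2Bound unitMeasure
      (fun z => ∑ j ∈ Finset.Ioc J (n - 1), discWaveCoeff n j t x * phi j (kappa n z))
      (1 / √J) := by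
  refine hasL2Bound_sum_of_orthonormal _ (fun j z => phi j (kappa n z)) _
    (fun j _ => memLp_phi_kappa n j) (fun i hi j hj => ?_) (by positivity)
    (sum_sq_tail_le hJ fun j hj => abs_discWaveCoeff_le ?_ t x)
  · have h1 := Finset.mem_Ioc.1 hi
    have h2 := Finset.mem_Ioc.1 hj
    exact integral_phi_kappa_mul (by omega) (by omega) (by omega) (by omega)
  · have := Finset.mem_Ioc.1 hj
    omega

lemma exists_one_div_sqrt_le {ε : ℝ} (hε : 0 < ε) : ∃ J : ℕ, 1 ≤ J ∧ 1 / √(J : ℝ) ≤ ε := by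
  have h : Tendsto (fun J : ℕ => 1 / √(J : ℝ)) atTop (𝓝 0) := by
    simp_rw [one_div]
    exact tendsto_inv_atTop_zero.comp (Real.tendsto_sqrt_atTop.comp tendsto_natCast_atTop_atTop)
  obtain ⟨J, h1, h2⟩ := ((eventually_ge_atTop 1).and (h.eventually (ge_mem_nhds hε))).exists
  exact ⟨J, h1, h2⟩

/-- J is chosen first, so that the tails of both kernels are below ε/3 whatever n is. The J low
modes then converge uniformly for t in [0,T] and all x. -/
lemma eventually_hasL2Bound_discGreen_sub (T : ℝ) {ε : ℝ} (hε : 0 < ε) :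
    ∀ᶠ n in atTop, ∀ t ∈ Icc 0 T, ∀ x,
      HasL2Bound unitMeasure (fun z => discGreen n t x z - green t x z) ε := by
  obtain ⟨J, hJ, hJε⟩ := exists_one_div_sqrt_le (show 0 < ε / 3 by positivity)
  choose β hβ hβle using exists_discWaveCoeff_sub_le T
  have hlim : Tendsto (fun n : ℕ => ∑ j ∈ Finset.Icc 1 J,
      (β j n * √2 + √2 * (j * Real.pi) * (1 / n))) atTop (𝓝 0) := by
    have h0 : ∀ j ∈ Finset.Icc 1 J, Tendsto (fun n : ℕ =>
        β j n * √2 + √2 * (j * Real.pi) * (1 / n)) atTop (𝓝 0) := fun j _ => by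
      simpa using ((hβ j).mul_const √2).add
        ((tendsto_one_div_atTop_nhds_zero_nat (𝕜 := ℝ)).const_mul (√2 * (j * Real.pi)))
    simpa using tendsto_finsetSum _ h0
  have hall : ∀ᶠ n in atTop, ∀ j ∈ Finset.Icc 1 J, ∀ t ∈ Icc 0 T, ∀ x,
      |discWaveCoeff n j t x - waveCoeff j t x| ≤ β j n :=
    (Filter.eventually_all_finset _).2 fun j _ => hβle j
  filter_upwards [hall, hlim.eventually (ge_mem_nhds (show 0 < ε / 3 by positivity)),
    eventually_gt_atTop J] with n h1 h2 hnJ t ht x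
  have hn : 0 < n := by omega
  have hlow : HasL2Bound unitMeasure (fun z => ∑ j ∈ Finset.Icc 1 J,
      (discWaveCoeff n j t x * phi j (kappa n z) - waveCoeff j t x * phi j z)) (ε / 3) := by
    refine .of_abs_le_unit (by positivity) ?_ fun z hz => le_trans ?_ h2
    · refine (Finset.measurable_fun_sum _ fun j _ => ?_).aestronglyMeasurable
      exact (((continuous_phi j).measurable.comp (measurable_kappa n)).const_mul _).sub
        ((continuous_phi j).measurable.const_mul _)
    · refine (Finset.abs_sum_le_sum_abs _ _).trans (Finset.sum_le_sum fun j hj => ?_)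
      rw [show discWaveCoeff n j t x * phi j (kappa n z) - waveCoeff j t x * phi j z
        = (discWaveCoeff n j t x - waveCoeff j t x) * phi j (kappa n z)
          + waveCoeff j t x * (phi j (kappa n z) - phi j z) by ring]
      refine (abs_add_le _ _).trans ?_
      rw [abs_mul, abs_mul]
      have hj1 : (1 : ℝ) ≤ j := by exact_mod_cast (Finset.mem_Icc.1 hj).1
      have h3 := h1 j hj t ht x
      have h4 : |waveCoeff j t x| ≤ 1 := (abs_waveCoeff_le j t x).trans (by
        rw [div_le_one (by positivity)]; exact hj1)
      have h5 : |phi j (kappa n z) - phi j z| ≤ √2 * (j * Real.pi) * (1 / n) :=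
        (abs_phi_sub_le _ _ _).trans (by
          have := Real.pi_pos
          gcongr; exact abs_kappa_sub_le hn z)
      refine add_le_add (mul_le_mul h3 (abs_phi_le _ _) (abs_nonneg _)
        ((abs_nonneg _).trans h3)) ?_
      calc _ ≤ 1 * (√2 * (j * Real.pi) * (1 / n)) :=
            mul_le_mul h4 h5 (abs_nonneg _) zero_le_one
        _ = _ := one_mul _
  have := (hlow.add ((hasL2Bound_discGreen_tail hJ n t x).mono hJε)).sub
    ((hasL2Bound_green_sub_greenPartial hJ t x).mono hJε)
  refine (this.congr (ae_of_all _ fun z => ?_)).mono (by linarith)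
  simp only [greenPartial_eq_sum, discGreen_eq_sum, Finset.sum_sub_distrib]
  rw [sum_Icc_eq_add_sum_Ioc (fun j => discWaveCoeff n j t x * phi j (kappa n z))
    (show J ≤ n - 1 by omega)]
  ring

/-- The constant is independent of j: the factor jπ produced by differentiating in t or x cancels
the denominator. -/
lemma abs_waveCoeff_sub_le (j : ℕ) (t x t' x' : ℝ) :
    |waveCoeff j t x - waveCoeff j t' x'| ≤ √2 * (|t - t'| + |x - x'|) := by
  rcases Nat.eq_zero_or_pos j with rfl | hj
  · simp [waveCoeff]; positivity
  have hj' : (0 : ℝ) < j := by exact_mod_cast hj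
  have hpi := Real.pi_pos
  have h1 : |Real.sin (j * Real.pi * t) / (j * Real.pi)
      - Real.sin (j * Real.pi * t') / (j * Real.pi)| ≤ |t - t'| := by
    rw [← sub_div, abs_div, abs_of_pos (show 0 < j * Real.pi by positivity),
      div_le_iff₀ (by positivity)]
    refine (abs_sin_sub_sin_le _ _).trans (le_of_eq ?_)
    rw [← mul_sub, abs_mul, abs_of_pos (show 0 < j * Real.pi by positivity), mul_comm]
  have h2 : |Real.sin (j * Real.pi * t') / (j * Real.pi)| ≤ 1 / (j * Real.pi) := by
    rw [abs_div, abs_of_pos (show 0 < j * Real.pi by positivity)]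
    gcongr; exact Real.abs_sin_le_one _
  rw [waveCoeff, waveCoeff, show ∀ a b c d : ℝ, a * b - c * d = (a - c) * b + c * (b - d) by
    intros; ring]
  refine (abs_add_le _ _).trans ?_
  rw [abs_mul, abs_mul, mul_add]
  refine add_le_add ?_ ?_
  · rw [mul_comm √2]
    exact mul_le_mul h1 (abs_phi_le _ _) (abs_nonneg _) (abs_nonneg _)
  · refine (mul_le_mul h2 (abs_phi_sub_le j x x') (abs_nonneg _) (by positivity)).trans
      (le_of_eq ?_)
    field_simp

lemma exists_hasL2Bound_green_sub {ε : ℝ} (hε : 0 < ε) : ∃ δ > 0, ∀ t x t' x' : ℝ,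
    |t - t'| ≤ δ → |x - x'| ≤ δ →
      HasL2Bound unitMeasure (fun z => green t x z - green t' x' z) ε := by
  obtain ⟨J, hJ, hJε⟩ := exists_one_div_sqrt_le (show 0 < ε / 3 by positivity)
  have hJ' : (0 : ℝ) < J := by exact_mod_cast hJ
  -- Each of the J low modes changes by at most √2 · 2δ · √2 = 4δ, so δ = ε/(12J) makes their total
  -- at most ε/3.
  refine ⟨ε / (12 * J), by positivity, fun t x t' x' ht hx => ?_⟩
  have hlow : HasL2Bound unitMeasure
      (fun z => greenPartial J t x z - greenPartial J t' x' z) (ε / 3) := by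
    refine .of_abs_le_unit (by positivity)
      ((hasL2Bound_greenPartial J t x).aesm.sub (hasL2Bound_greenPartial J t' x').aesm)
      fun z _ => ?_
    rw [greenPartial_eq_sum, greenPartial_eq_sum, ← Finset.sum_sub_distrib]
    refine (Finset.abs_sum_le_sum_abs _ _).trans ?_
    calc _ ≤ ∑ j ∈ Finset.Icc 1 J, 2 * (ε / (12 * J) + ε / (12 * J)) := by
          refine Finset.sum_le_sum fun j _ => ?_
          rw [← sub_mul, abs_mul]
          calc _ ≤ √2 * (|t - t'| + |x - x'|) * √2 := mul_le_mul (abs_waveCoeff_sub_le _ _ _ _ _)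
                (abs_phi_le _ _) (abs_nonneg _) (by positivity)
            _ = (√2 * √2) * (|t - t'| + |x - x'|) := by ring
            _ ≤ _ := by rw [Real.mul_self_sqrt (by norm_num)]; gcongr
      _ = ε / 3 := by
          rw [Finset.sum_const, Nat.card_Icc, nsmul_eq_mul, Nat.add_sub_cancel]
          field_simp; norm_num
  have := (hlow.add ((hasL2Bound_green_sub_greenPartial hJ t x).mono hJε)).sub
    ((hasL2Bound_green_sub_greenPartial hJ t' x').mono hJε)
  exact (this.congr (ae_of_all _ fun z => by ring)).mono (by linarith)

/-! ### Convergence of the contribution of the initial data -/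

/-- The part of the skeleton equation that depends only on the initial data. -/
def initialPart (u v : ℝ → ℝ) (t x : ℝ) : ℝ :=
  (∫ z in (0 : ℝ)..1, green t x z * v z) + deriv (fun r => ∫ z in (0 : ℝ)..1, green r x z * u z) t

/-- The part of the discrete skeleton equation that depends only on the initial data. -/
def discInitialPart (n : ℕ) (u v : ℝ → ℝ) (t x : ℝ) : ℝ :=
  (∫ z in (0 : ℝ)..1, discGreen n t x z * v (kappa n z))
    + ∫ z in (0 : ℝ)..1, deriv (fun r => discGreen n r x z) t * u (kappa n z)

/-- The sine coefficients of `u`. -/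
def sineCoeff (u : ℝ → ℝ) (j : ℕ) : ℝ := ∫ z, phi j z * u z ∂unitMeasure

/-- The discrete sine coefficients of `u`. -/
def discSineCoeff (n : ℕ) (u : ℝ → ℝ) (j : ℕ) : ℝ :=
  ∫ z, phi j (kappa n z) * u (kappa n z) ∂unitMeasure

lemma exists_hasL2Bound_of_continuousOn {v : ℝ → ℝ} (hv : ContinuousOn v (Icc 0 1)) :
    ∃ C, 0 ≤ C ∧ HasL2Bound unitMeasure v C ∧
      ∀ n, 0 < n → HasL2Bound unitMeasure (fun z => v (kappa n z)) C := by
  obtain ⟨C, hC⟩ := isCompact_Icc.exists_bound_of_continuousOn hv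
  have hC0 : 0 ≤ C := (norm_nonneg _).trans (hC 0 (by simp))
  exact ⟨C, hC0, .of_abs_le_unit hC0 (hv.aestronglyMeasurable measurableSet_Icc) hC,
    fun n hn => .of_abs_le_unit hC0 (aestronglyMeasurable_comp_kappa hn hv)
      fun z hz => hC _ (kappa_mem hn hz)⟩

lemma eventually_abs_comp_kappa_sub_le {v : ℝ → ℝ} (hv : ContinuousOn v (Icc 0 1)) {ε : ℝ}
    (hε : 0 < ε) : ∀ᶠ n in atTop, ∀ z ∈ Icc (0 : ℝ) 1, |v (kappa n z) - v z| ≤ ε := by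
  have huc := isCompact_Icc.uniformContinuousOn_of_continuous hv
  obtain ⟨δ, hδ, h⟩ := Metric.uniformContinuousOn_iff.1 huc ε hε
  filter_upwards [eventually_gt_atTop 0,
    (tendsto_one_div_atTop_nhds_zero_nat (𝕜 := ℝ)).eventually (gt_mem_nhds hδ)] with n hn hnδ z hz
  exact (h _ (kappa_mem hn hz) _ hz ((abs_kappa_sub_le hn z).trans_lt hnδ)).le

lemma integral_sum_mul_mul (S : Finset ℕ) (c : ℕ → ℝ) {e : ℕ → ℝ → ℝ} {g : ℝ → ℝ}
    (he : ∀ j, MemLp (e j) 2 unitMeasure) (hg : MemLp g 2 unitMeasure) :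
    ∫ z, (∑ j ∈ S, c j * e j z) * g z ∂unitMeasure
      = ∑ j ∈ S, c j * ∫ z, e j z * g z ∂unitMeasure := by
  have hi : ∀ j ∈ S, Integrable (fun z => c j * (e j z * g z)) unitMeasure := fun j _ =>
    ((he j).integrable_mul hg).const_mul _
  simp_rw [Finset.sum_mul, mul_assoc]
  rw [integral_finsetSum _ hi]
  exact Finset.sum_congr rfl fun j _ => integral_const_mul _ _

section Velocity

variable {v : ℝ → ℝ}

lemma integral_green_mul_eq (t x : ℝ) (v : ℝ → ℝ) :
    ∫ z in (0 : ℝ)..1, green t x z * v z = ∫ z, green t x z * v z ∂unitMeasure :=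
  (integral_unitMeasure _).symm

lemma continuous_integral_green_mul (hv : ContinuousOn v (Icc 0 1)) :
    Continuous fun p : ℝ × ℝ => ∫ z, green p.1 p.2 z * v z ∂unitMeasure := by
  obtain ⟨C, hC0, hC, -⟩ := exists_hasL2Bound_of_continuousOn hv
  rw [Metric.continuous_iff]
  intro p ε hε
  obtain ⟨δ, hδ, h⟩ := exists_hasL2Bound_green_sub (show 0 < ε / (C + 1) by positivity)
  refine ⟨δ, hδ, fun q hq => ?_⟩
  have hq' := hq.le
  rw [Prod.dist_eq, max_le_iff] at hq'
  have := abs_integral_mul_le (h _ _ _ _ hq'.1 hq'.2) hC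
  rw [Real.dist_eq, ← integral_sub ((hasL2Bound_green _ _).integrable_mul hC)
    ((hasL2Bound_green _ _).integrable_mul hC)]
  simp_rw [← sub_mul]
  refine this.trans_lt ?_
  rw [div_mul_eq_mul_div, div_lt_iff₀ (by positivity)]
  nlinarith

lemma eventually_abs_integral_discGreen_sub_le (hv : ContinuousOn v (Icc 0 1)) (T : ℝ) {ε : ℝ}
    (hε : 0 < ε) : ∀ᶠ n in atTop, ∀ t ∈ Icc 0 T, ∀ x,
      |∫ z, discGreen n t x z * v (kappa n z) ∂unitMeasure - ∫ z, green t x z * v z ∂unitMeasure|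
        ≤ ε := by
  obtain ⟨C, hC0, hC, hCn⟩ := exists_hasL2Bound_of_continuousOn hv
  filter_upwards [eventually_gt_atTop 0,
    eventually_hasL2Bound_discGreen_sub T (show 0 < ε / (2 * (C + 1)) by positivity),
    eventually_abs_comp_kappa_sub_le hv (show 0 < ε / 4 by positivity)] with n hn h1 h2 t ht x
  have h3 := abs_integral_mul_le (h1 t ht x) (hCn n hn)
  have hsub : HasL2Bound unitMeasure (fun z => v (kappa n z) - v z) (ε / 4) :=
    .of_abs_le_unit (by positivity) ((hCn n hn).aesm.sub hC.aesm) h2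
  have h4 := abs_integral_mul_le (hasL2Bound_green t x) hsub
  have e : ∫ z, discGreen n t x z * v (kappa n z) ∂unitMeasure
      - ∫ z, green t x z * v z ∂unitMeasure
      = ∫ z, (discGreen n t x z - green t x z) * v (kappa n z) ∂unitMeasure
        + ∫ z, green t x z * (v (kappa n z) - v z) ∂unitMeasure := by
    rw [← integral_add ((h1 t ht x).integrable_mul (hCn n hn))
      ((hasL2Bound_green t x).integrable_mul hsub),
      ← integral_sub ((hasL2Bound_discGreen n t x).integrable_mul (hCn n hn))
      ((hasL2Bound_green t x).integrable_mul hC)]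
    exact integral_congr_ae (ae_of_all _ fun z => by ring)
  rw [e]
  refine (abs_add_le _ _).trans ?_
  have h5 : ε / (2 * (C + 1)) * C ≤ ε / 2 := by
    rw [div_mul_eq_mul_div, div_le_div_iff₀ (by positivity) (by norm_num)]
    nlinarith
  linarith

lemma integral_discGreen_mul {n : ℕ} (hn : 0 < n) (hv : ContinuousOn v (Icc 0 1)) (t x : ℝ) :
    ∫ z, discGreen n t x z * v (kappa n z) ∂unitMeasure
      = ∑ j ∈ Finset.Icc 1 (n - 1), discWaveCoeff n j t x * discSineCoeff n v j := by
  obtain ⟨C, hC0, -, hCn⟩ := exists_hasL2Bound_of_continuousOn hv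
  simp_rw [discGreen_eq_sum]
  exact integral_sum_mul_mul _ _ (memLp_phi_kappa n) (hCn n hn).memLp

lemma integral_deriv_discGreen_mul {n : ℕ} (hn : 0 < n) (hv : ContinuousOn v (Icc 0 1))
    (t x : ℝ) :
    ∫ z, deriv (fun r => discGreen n r x z) t * v (kappa n z) ∂unitMeasure
      = ∑ j ∈ Finset.Icc 1 (n - 1), Real.cos (j * Real.pi * t * √(discCoeff n j))
          * interp n (phi j) x * discSineCoeff n v j := by
  obtain ⟨C, hC0, -, hCn⟩ := exists_hasL2Bound_of_continuousOn hv
  have hderiv : ∀ z, deriv (fun r => discGreen n r x z) t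
      = ∑ j ∈ Finset.Icc 1 (n - 1), Real.cos (j * Real.pi * t * √(discCoeff n j))
          * interp n (phi j) x * phi j (kappa n z) := fun z => by
    refine HasDerivAt.deriv ?_
    unfold discGreen
    refine HasDerivAt.fun_sum fun j hj => ?_
    have hj' := Finset.mem_Icc.1 hj
    have hs := two_div_pi_le_sqrt_discCoeff hj'.1 (show j ≤ n by omega)
    have hpi := Real.pi_pos
    have hs0 : 0 < √(discCoeff n j) := lt_of_lt_of_le (by positivity) hs
    have hj0 : (0 : ℝ) < j := by exact_mod_cast hj'.1
    have h1 : HasDerivAt (fun r => j * Real.pi * r * √(discCoeff n j))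
        (j * Real.pi * √(discCoeff n j)) t := by
      simpa using (((hasDerivAt_id t).const_mul (j * Real.pi)).mul_const (√(discCoeff n j)))
    have h2 := (((h1.sin).div_const (j * Real.pi * √(discCoeff n j))).mul_const
      (interp n (phi j) x)).mul_const (phi j (kappa n z))
    rwa [mul_div_cancel_right₀ _ (by positivity)] at h2
  simp_rw [hderiv]
  exact integral_sum_mul_mul _ _ (memLp_phi_kappa n) (hCn n hn).memLp

end Velocity

section Position

/-- The grid bound does not depend on n, so it survives the limit n → ∞, and one D dominates both
families of coefficients. -/
lemma exists_abs_sineCoeff_le {u : ℝ → ℝ} (hu : ContDiffOn ℝ 2 u (Icc 0 1)) (hu0 : u 0 = 0)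
    (hu1 : u 1 = 0) : ∃ D, 0 ≤ D ∧
      (∀ n j : ℕ, 1 ≤ j → j < n → |discSineCoeff n u j| ≤ D * (1 / (j : ℝ) ^ 2)) ∧
      ∀ j : ℕ, |sineCoeff u j| ≤ D * (1 / (j : ℝ) ^ 2) := by
  obtain ⟨D, hD0, hD⟩ := exists_abs_integral_phi_kappa_le hu hu0 hu1
  refine ⟨D, hD0, hD, fun j => ?_⟩
  rcases Nat.eq_zero_or_pos j with rfl | hj
  -- φ_0 = 0 and 1/0² = 0, so the bound also holds at j = 0 and the series can run over all of ℕ.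
  · simp [sineCoeff, phi]
  have h := tendsto_integral_comp_kappa (g := fun z => phi j z * u z)
    ((continuous_phi j).continuousOn.mul hu.continuousOn)
  refine le_of_tendsto h.abs ?_
  filter_upwards [eventually_gt_atTop j] with n hn using hD n j hj hn

variable {u : ℝ → ℝ}

lemma tendsto_discSineCoeff (hu : ContinuousOn u (Icc 0 1)) (j : ℕ) :
    Tendsto (fun n => discSineCoeff n u j) atTop (𝓝 (sineCoeff u j)) :=
  tendsto_integral_comp_kappa (g := fun z => phi j z * u z)
    ((continuous_phi j).continuousOn.mul hu)

lemma summable_const_mul_inv_sq (D : ℝ) : Summable fun j : ℕ => D * (1 / (j : ℝ) ^ 2) :=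
  (Real.summable_one_div_nat_pow.2 one_lt_two).mul_left D

/-- The decay of the coefficients gives absolute convergence, and the L² tail bound of the Green
function identifies the sum. -/
lemma hasSum_integral_green_mul (hu : ContDiffOn ℝ 2 u (Icc 0 1)) (hu0 : u 0 = 0)
    (hu1 : u 1 = 0) (t x : ℝ) :
    HasSum (fun j => waveCoeff j t x * sineCoeff u j) (∫ z, green t x z * u z ∂unitMeasure) := by
  obtain ⟨D, hD0, -, hD⟩ := exists_abs_sineCoeff_le hu hu0 hu1
  obtain ⟨C, hC0, hC, -⟩ := exists_hasL2Bound_of_continuousOn hu.continuousOn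
  have hsum : Summable fun j => waveCoeff j t x * sineCoeff u j := by
    refine (summable_const_mul_inv_sq D).of_norm_bounded fun j => ?_
    rw [norm_mul]
    have h1 : |waveCoeff j t x| ≤ 1 := (abs_waveCoeff_le j t x).trans (by
      rw [one_div]; exact Nat.cast_inv_le_one j)
    calc _ ≤ 1 * (D * (1 / (j : ℝ) ^ 2)) :=
          mul_le_mul h1 (hD j) (abs_nonneg _) zero_le_one
      _ = _ := one_mul _
  rw [hsum.hasSum_iff_tendsto_nat, ← tendsto_add_atTop_iff_nat 1]
  have hpart : ∀ N, ∑ j ∈ Finset.range (N + 1), waveCoeff j t x * sineCoeff u j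
      = ∫ z, greenPartial N t x z * u z ∂unitMeasure := by
    intro N
    simp_rw [greenPartial_eq_sum]
    rw [integral_sum_mul_mul _ _ memLp_phi hC.memLp, Finset.range_eq_Ico,
      Finset.sum_eq_sum_Ico_succ_bot (by omega), show waveCoeff 0 t x = 0 by simp [waveCoeff],
      zero_mul, zero_add]
    rfl
  simp_rw [hpart]
  rw [Metric.tendsto_atTop]
  intro ε hε
  obtain ⟨J, hJ, hJε⟩ := exists_one_div_sqrt_le (show 0 < ε / (C + 1) by positivity)
  refine ⟨J, fun N hN => ?_⟩
  have h1 := abs_integral_mul_le (hasL2Bound_green_sub_greenPartial (hJ.trans hN) t x) hC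
  rw [dist_comm, Real.dist_eq, ← integral_sub ((hasL2Bound_green t x).integrable_mul hC)
    ((hasL2Bound_greenPartial N t x).integrable_mul hC)]
  simp_rw [← sub_mul]
  have hJ' : (0 : ℝ) < J := by exact_mod_cast hJ
  have h2 : 1 / √(N : ℝ) ≤ ε / (C + 1) := le_trans (by gcongr) hJε
  calc _ ≤ 1 / √(N : ℝ) * C := h1
    _ ≤ ε / (C + 1) * C := by gcongr
    _ < ε := by rw [div_mul_eq_mul_div, div_lt_iff₀ (by positivity)]; nlinarith

lemma abs_cos_mul_phi_mul_le {D p : ℝ} (j : ℕ) (t x : ℝ) (hD : |p| ≤ D) :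
    |Real.cos (j * Real.pi * t) * phi j x * p| ≤ √2 * D := by
  rw [abs_mul, abs_mul]
  have h1 := Real.abs_cos_le_one (j * Real.pi * t)
  have h2 := abs_phi_le j x
  calc _ ≤ 1 * √2 * D := by gcongr
    _ = _ := by ring

/-- Termwise differentiation is legitimate because the differentiated series is dominated by √2
D/j², uniformly in time. -/
lemma deriv_integral_green_mul (hu : ContDiffOn ℝ 2 u (Icc 0 1)) (hu0 : u 0 = 0)
    (hu1 : u 1 = 0) (t x : ℝ) :
    deriv (fun r => ∫ z, green r x z * u z ∂unitMeasure) t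
      = ∑' j : ℕ, Real.cos (j * Real.pi * t) * phi j x * sineCoeff u j := by
  obtain ⟨D, hD0, -, hD⟩ := exists_abs_sineCoeff_le hu hu0 hu1
  have h1 : (fun r => ∫ z, green r x z * u z ∂unitMeasure)
      = fun r => ∑' j, waveCoeff j r x * sineCoeff u j :=
    funext fun r => (hasSum_integral_green_mul hu hu0 hu1 r x).tsum_eq.symm
  rw [h1]
  have hderiv : ∀ (j : ℕ) (r : ℝ), HasDerivAt (fun r => waveCoeff j r x * sineCoeff u j)
      (Real.cos (j * Real.pi * r) * phi j x * sineCoeff u j) r := by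
    intro j r
    rcases Nat.eq_zero_or_pos j with rfl | hj
    · simpa [waveCoeff, phi] using hasDerivAt_const r (0 : ℝ)
    have hj0 : (0 : ℝ) < j := by exact_mod_cast hj
    have hpi := Real.pi_pos
    have h1 : HasDerivAt (fun r => j * Real.pi * r) (j * Real.pi) r := by
      simpa using (hasDerivAt_id r).const_mul (j * Real.pi)
    have h2 := ((h1.sin.div_const (j * Real.pi)).mul_const (phi j x)).mul_const (sineCoeff u j)
    rwa [mul_div_cancel_right₀ _ (by positivity)] at h2
  have hbound : ∀ (j : ℕ) (r : ℝ), ‖Real.cos (j * Real.pi * r) * phi j x * sineCoeff u j‖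
      ≤ √2 * (D * (1 / (j : ℝ) ^ 2)) := fun j r => abs_cos_mul_phi_mul_le j r x (hD j)
  have hsum := (hasSum_integral_green_mul hu hu0 hu1 t x).summable
  exact (hasDerivAt_tsum ((summable_const_mul_inv_sq D).mul_left √2) hderiv hbound hsum t).deriv

lemma continuous_tsum_position (hu : ContDiffOn ℝ 2 u (Icc 0 1)) (hu0 : u 0 = 0)
    (hu1 : u 1 = 0) :
    Continuous fun p : ℝ × ℝ =>
      ∑' j : ℕ, Real.cos (j * Real.pi * p.1) * phi j p.2 * sineCoeff u j := by
  obtain ⟨D, hD0, -, hD⟩ := exists_abs_sineCoeff_le hu hu0 hu1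
  exact continuous_tsum (fun j => by fun_prop) ((summable_const_mul_inv_sq D).mul_left √2)
    fun j p => abs_cos_mul_phi_mul_le j p.1 p.2 (hD j)

/-- Dominated convergence for series: each mode converges uniformly in (t, x), and D/j² dominates
discrete and continuous terms alike, up to a constant. -/
lemma eventually_abs_position_sub_le (hu : ContDiffOn ℝ 2 u (Icc 0 1)) (hu0 : u 0 = 0)
    (hu1 : u 1 = 0) (T : ℝ) {ε : ℝ} (hε : 0 < ε) : ∀ᶠ n in atTop, ∀ t ∈ Icc 0 T, ∀ x,
      |∑ j ∈ Finset.Icc 1 (n - 1), Real.cos (j * Real.pi * t * √(discCoeff n j))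
          * interp n (phi j) x * discSineCoeff n u j
        - ∑' j : ℕ, Real.cos (j * Real.pi * t) * phi j x * sineCoeff u j| ≤ ε := by
  obtain ⟨D, hD0, hDn, hD⟩ := exists_abs_sineCoeff_le hu hu0 hu1
  set d : ℕ × ℝ × ℝ → ℕ → ℝ := fun q j => if j ∈ Finset.Icc 1 (q.1 - 1) then
    Real.cos (j * Real.pi * q.2.1 * √(discCoeff q.1 j)) * interp q.1 (phi j) q.2.2
      * discSineCoeff q.1 u j else 0 with hd
  set c : ℕ × ℝ × ℝ → ℕ → ℝ := fun q j =>
    Real.cos (j * Real.pi * q.2.1) * phi j q.2.2 * sineCoeff u j with hc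
  have hcle : ∀ q j, |c q j| ≤ √2 * (D * (1 / (j : ℝ) ^ 2)) := fun q j =>
    abs_cos_mul_phi_mul_le j _ _ (hD j)
  have hdle : ∀ q j, |d q j| ≤ √2 * (D * (1 / (j : ℝ) ^ 2)) := fun q j => by
    simp only [hd]
    split_ifs with h
    · have h' := Finset.mem_Icc.1 h
      rw [abs_mul, abs_mul]
      have h1 := Real.abs_cos_le_one (j * Real.pi * q.2.1 * √(discCoeff q.1 j))
      have h2 := abs_interp_le (abs_phi_le j) q.1 q.2.2
      calc _ ≤ 1 * √2 * (D * (1 / (j : ℝ) ^ 2)) := by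
            gcongr
            exact hDn _ _ h'.1 (by omega)
        _ = _ := by ring
    · simp; positivity
  have hS := (summable_const_mul_inv_sq D).mul_left √2
  -- Convergence along this filter is convergence as n → ∞, uniformly in t ∈ [0,T] and x.
  set 𝓕 : Filter (ℕ × ℝ × ℝ) := atTop ×ˢ 𝓟 (Icc 0 T ×ˢ univ) with h𝓕
  have hlim : Tendsto (fun q => ∑' j, (d q j - c q j)) 𝓕 (𝓝 (∑' _ : ℕ, (0 : ℝ))) := by
    refine tendsto_tsum_of_dominated_convergence (hS.mul_left 2) (fun j => ?_)
      (Eventually.of_forall fun q j => ?_)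
    · rcases Nat.eq_zero_or_pos j with rfl | hj
      · have : ∀ q, d q 0 - c q 0 = 0 := fun q => by simp [hd, hc, phi]
        simp_rw [this]; exact tendsto_const_nhds
      obtain ⟨β, hβ, hβle⟩ := exists_cos_interp_sub_le T hj
      set M := D * (1 / (j : ℝ) ^ 2)
      have hB : Tendsto (fun n => β n * M + √2 * |discSineCoeff n u j - sineCoeff u j|) atTop
          (𝓝 0) := by
        simpa using (hβ.mul_const M).add
          (((tendsto_discSineCoeff hu.continuousOn j).sub_const (sineCoeff u j)).abs.const_mul √2)
      refine squeeze_zero_norm' ?_ (hB.comp (tendsto_fst (g := 𝓟 (Icc 0 T ×ˢ univ))))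
      rw [h𝓕, eventually_prod_principal_iff]
      filter_upwards [hβle, eventually_gt_atTop j] with n h1 hn p hp
      have hmem : j ∈ Finset.Icc 1 (n - 1) := Finset.mem_Icc.2 ⟨hj, by omega⟩
      simp only [hd, hc, hmem, if_true, Function.comp]
      rw [show ∀ a b c d : ℝ, a * b - c * d = (a - c) * b + c * (b - d) by intros; ring]
      refine (norm_add_le _ _).trans ?_
      rw [Real.norm_eq_abs, Real.norm_eq_abs, abs_mul, abs_mul (Real.cos _ * _)]
      have h2 := h1 p.1 hp.1 p.2
      refine add_le_add (mul_le_mul h2 (hDn n j hj hn) (abs_nonneg _)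
        ((abs_nonneg _).trans h2)) ?_
      gcongr
      rw [abs_mul]
      calc _ ≤ 1 * √2 := mul_le_mul (Real.abs_cos_le_one _) (abs_phi_le _ _) (abs_nonneg _)
            zero_le_one
        _ = _ := one_mul _
    · refine (norm_sub_le _ _).trans ?_
      rw [two_mul]
      exact add_le_add (hdle q j) (hcle q j)
  rw [tsum_zero] at hlim
  have hev := hlim.abs.eventually (ge_mem_nhds (show |(0 : ℝ)| < ε by simpa using hε))
  rw [h𝓕, eventually_prod_principal_iff] at hev
  filter_upwards [hev] with n hn t ht x
  have h := hn (t, x) ⟨ht, mem_univ _⟩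
  rw [Summable.tsum_sub (hS.of_norm_bounded (hdle _)) (hS.of_norm_bounded (hcle _))] at h
  rw [tsum_eq_sum (f := d (n, t, x)) (s := Finset.Icc 1 (n - 1)) fun j hj => by
    simp only [hd, if_neg hj], Finset.sum_congr rfl fun j hj => if_pos hj] at h
  exact h

end Position

section InitialPart

variable {u v : ℝ → ℝ}

lemma initialPart_eq (hu : ContDiffOn ℝ 2 u (Icc 0 1)) (hu0 : u 0 = 0) (hu1 : u 1 = 0)
    (v : ℝ → ℝ) (t x : ℝ) : initialPart u v t x
    = ∫ z, green t x z * v z ∂unitMeasure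
      + ∑' j : ℕ, Real.cos (j * Real.pi * t) * phi j x * sineCoeff u j := by
  simp only [initialPart, integral_green_mul_eq]
  rw [deriv_integral_green_mul hu hu0 hu1]

lemma discInitialPart_eq {n : ℕ} (hn : 0 < n) (hu : ContinuousOn u (Icc 0 1)) (v : ℝ → ℝ)
    (t x : ℝ) : discInitialPart n u v t x
    = ∫ z, discGreen n t x z * v (kappa n z) ∂unitMeasure
      + ∑ j ∈ Finset.Icc 1 (n - 1), Real.cos (j * Real.pi * t * √(discCoeff n j))
          * interp n (phi j) x * discSineCoeff n u j := by
  rw [discInitialPart, ← integral_unitMeasure, ← integral_unitMeasure,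
    integral_deriv_discGreen_mul hn hu]

lemma continuous_initialPart (hu : ContDiffOn ℝ 2 u (Icc 0 1)) (hu0 : u 0 = 0) (hu1 : u 1 = 0)
    (hv : ContinuousOn v (Icc 0 1)) : Continuous fun p : ℝ × ℝ => initialPart u v p.1 p.2 := by
  simp_rw [initialPart_eq hu hu0 hu1]
  exact (continuous_integral_green_mul hv).add (continuous_tsum_position hu hu0 hu1)

lemma continuous_discInitialPart {n : ℕ} (hn : 0 < n) (hu : ContinuousOn u (Icc 0 1))
    (hv : ContinuousOn v (Icc 0 1)) :
    Continuous fun p : ℝ × ℝ => discInitialPart n u v p.1 p.2 := by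
  have h := fun j => continuous_interp n (phi j)
  have h' := continuous_discWaveCoeff n
  simp_rw [discInitialPart_eq hn hu, integral_discGreen_mul hn hv]
  refine (continuous_finsetSum _ fun j _ => (h' j).mul continuous_const).add
    (continuous_finsetSum _ fun j _ => ?_)
  have := h j
  fun_prop

lemma eventually_abs_discInitialPart_sub_le (hu : ContDiffOn ℝ 2 u (Icc 0 1)) (hu0 : u 0 = 0)
    (hu1 : u 1 = 0) (hv : ContinuousOn v (Icc 0 1)) (T : ℝ) {ε : ℝ} (hε : 0 < ε) :
    ∀ᶠ n in atTop, ∀ t ∈ Icc 0 T, ∀ x,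
      |discInitialPart n u v t x - initialPart u v t x| ≤ ε := by
  filter_upwards [eventually_gt_atTop 0,
    eventually_abs_integral_discGreen_sub_le hv T (half_pos hε),
    eventually_abs_position_sub_le hu hu0 hu1 T (half_pos hε)] with n hn h1 h2 t ht x
  rw [initialPart_eq hu hu0 hu1, discInitialPart_eq hn hu.continuousOn, add_sub_add_comm]
  exact (abs_add_le _ _).trans (by linarith [h1 t ht x, h2 t ht x])

end InitialPart

/-! ### Duhamel integrals -/

/-- The properties of the two Green functions that the comparison of the skeleton equations
uses. -/
structure IsKernel (G : ℝ → ℝ → ℝ → ℝ) : Prop where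
  meas : Measurable fun q : ℝ × ℝ × ℝ => G q.1 q.2.1 q.2.2
  zero : ∀ x z, G 0 x z = 0
  bound : ∀ t x, HasL2Bound unitMeasure (G t x) 2

lemma isKernel_green : IsKernel green := ⟨measurable_green, green_zero, hasL2Bound_green⟩

lemma isKernel_discGreen (n : ℕ) : IsKernel (discGreen n) :=
  ⟨measurable_discGreen n, discGreen_zero n, hasL2Bound_discGreen n⟩

/-- The Duhamel integral `∫_0^t ∫_0^1 G_{t-s}(x,z) F(s,z) dz ds` for a kernel with `G_0 = 0`. -/
def duhamel (T : ℝ) (G : ℝ → ℝ → ℝ → ℝ) (F : ℝ × ℝ → ℝ) (t x : ℝ) : ℝ :=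
  ∫ p, G (max (t - p.1) 0) x p.2 * F p ∂spaceTimeMeasure T

section Kernel

variable {G G' : ℝ → ℝ → ℝ → ℝ} {T : ℝ}

lemma IsKernel.measurable_shift (hG : IsKernel G) (t x : ℝ) :
    Measurable fun p : ℝ × ℝ => G (max (t - p.1) 0) x p.2 := by
  have h : Measurable fun p : ℝ × ℝ => (max (t - p.1) 0, x, p.2) := by fun_prop
  exact hG.meas.comp h

lemma IsKernel.hasL2Bound_shift (hG : IsKernel G) (hT : 0 ≤ T) (t x : ℝ) :
    HasL2Bound (spaceTimeMeasure T) (fun p => G (max (t - p.1) 0) x p.2) (2 * √T) :=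
  .of_sections_const hT (hG.measurable_shift t x) zero_le_two fun s _ =>
    hG.bound (max (t - s) 0) x

lemma hasL2Bound_shift_sub (hG : IsKernel G) (hG' : IsKernel G') (hT : 0 ≤ T) {t x t' x' ε : ℝ}
    (hε : 0 ≤ ε) (h : ∀ s ∈ Icc 0 T, HasL2Bound unitMeasure
      (fun z => G (max (t - s) 0) x z - G' (max (t' - s) 0) x' z) ε) :
    HasL2Bound (spaceTimeMeasure T)
      (fun p => G (max (t - p.1) 0) x p.2 - G' (max (t' - p.1) 0) x' p.2) (ε * √T) :=
  .of_sections_const hT ((hG.measurable_shift t x).sub (hG'.measurable_shift t' x')) hε h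

lemma IsKernel.integrable_shift_mul (hG : IsKernel G) (hT : 0 ≤ T) {F : ℝ × ℝ → ℝ} {R : ℝ}
    (hF : HasL2Bound (spaceTimeMeasure T) F R) (t x : ℝ) :
    Integrable (fun p => G (max (t - p.1) 0) x p.2 * F p) (spaceTimeMeasure T) :=
  (hG.hasL2Bound_shift hT t x).integrable_mul hF

lemma IsKernel.abs_duhamel_le (hG : IsKernel G) (hT : 0 ≤ T) {F : ℝ × ℝ → ℝ} {R : ℝ}
    (hF : HasL2Bound (spaceTimeMeasure T) F R) (t x : ℝ) :
    |duhamel T G F t x| ≤ 2 * √T * R :=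
  abs_integral_mul_le (hG.hasL2Bound_shift hT t x) hF

lemma abs_duhamel_sub_le (hG : IsKernel G) (hG' : IsKernel G') (hT : 0 ≤ T) {t x t' x' ε : ℝ}
    (hε : 0 ≤ ε) (h : ∀ s ∈ Icc 0 T, HasL2Bound unitMeasure
      (fun z => G (max (t - s) 0) x z - G' (max (t' - s) 0) x' z) ε) {F : ℝ × ℝ → ℝ} {R : ℝ}
    (hF : HasL2Bound (spaceTimeMeasure T) F R) :
    |duhamel T G F t x - duhamel T G' F t' x'| ≤ ε * √T * R := by
  have h1 := abs_integral_mul_le (hasL2Bound_shift_sub hG hG' hT hε h) hF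
  simp_rw [sub_mul] at h1
  rwa [integral_sub (hG.integrable_shift_mul hT hF t x)
    (hG'.integrable_shift_mul hT hF t' x')] at h1

lemma IsKernel.duhamel_add_const_mul (hG : IsKernel G) (hT : 0 ≤ T) {F F' : ℝ × ℝ → ℝ} {R R' : ℝ}
    (hF : HasL2Bound (spaceTimeMeasure T) F R) (hF' : HasL2Bound (spaceTimeMeasure T) F' R')
    (c t x : ℝ) : duhamel T G (fun p => F p + c * F' p) t x
      = duhamel T G F t x + c * duhamel T G F' t x := by
  unfold duhamel
  rw [← integral_const_mul, ← integral_add (hG.integrable_shift_mul hT hF t x)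
    ((hG.integrable_shift_mul hT hF' t x).const_mul c)]
  exact integral_congr_ae (ae_of_all _ fun p => by ring)

lemma duhamel_congr {F F' : ℝ × ℝ → ℝ} (h : F =ᵐ[spaceTimeMeasure T] F') (t x : ℝ) :
    duhamel T G F t x = duhamel T G F' t x := by
  refine integral_congr_ae ?_
  filter_upwards [h] with p hp
  rw [hp]

/-- Times s > t contribute nothing since G_0 = 0. Hence the domain can be taken independent of t,
and integrals at different times are compared by subtracting integrands. -/
lemma IsKernel.setIntegral_eq_duhamel (hG : IsKernel G) (F : ℝ × ℝ → ℝ) {t : ℝ}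
    (ht : t ∈ Icc 0 T) (x : ℝ) :
    ∫ p in Icc 0 t ×ˢ Icc (0 : ℝ) 1, G (t - p.1) x p.2 * F p = duhamel T G F t x := by
  have h1 : ∫ p in Icc 0 t ×ˢ Icc (0 : ℝ) 1, G (t - p.1) x p.2 * F p
      = ∫ p in Icc 0 t ×ˢ Icc (0 : ℝ) 1, G (max (t - p.1) 0) x p.2 * F p :=
    setIntegral_congr_fun (measurableSet_Icc.prod measurableSet_Icc) fun p hp => by
      simp only [max_eq_left (sub_nonneg.2 hp.1.2)]
  rw [h1, duhamel]
  refine (setIntegral_eq_of_subset_of_forall_sdiff_eq_zero (measurableSet_spaceTime T)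
    (prod_mono (Icc_subset_Icc_right ht.2) le_rfl) fun p hp => ?_).symm
  have h2 : t ≤ p.1 := by
    by_contra hlt
    exact hp.2 ⟨⟨hp.1.1.1, (not_le.1 hlt).le⟩, hp.1.2⟩
  rw [max_eq_right (sub_nonpos.2 h2), hG.zero, zero_mul]

lemma IsKernel.add_setIntegral_eq_duhamel (hG : IsKernel G) (hT : 0 ≤ T) {A S : ℝ × ℝ → ℝ}
    {h : ℝ × ℝ → ℝ} {R R' : ℝ} (hA : HasL2Bound (spaceTimeMeasure T) A R)
    (hS : HasL2Bound (spaceTimeMeasure T) (fun p => S p * h p) R') {t : ℝ} (ht : t ∈ Icc 0 T)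
    (x : ℝ) :
    (∫ p in Icc 0 t ×ˢ Icc (0 : ℝ) 1, G (t - p.1) x p.2 * A p)
      + ∫ p in Icc 0 t ×ˢ Icc (0 : ℝ) 1, G (t - p.1) x p.2 * S p * h p
      = duhamel T G (fun p => A p + S p * h p) t x := by
  simp_rw [mul_assoc]
  rw [hG.setIntegral_eq_duhamel A ht, hG.setIntegral_eq_duhamel (fun p => S p * h p) ht]
  simpa using (hG.duhamel_add_const_mul hT hA hS 1 t x).symm

/-- The Duhamel integrals of the Green function against a bounded set of densities are
equicontinuous. -/
lemma exists_abs_duhamel_green_sub_le (hT : 0 ≤ T) (R : ℝ) {ε : ℝ} (hε : 0 < ε) :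
    ∃ δ > 0, ∀ F, HasL2Bound (spaceTimeMeasure T) F R → ∀ t x t' x' : ℝ,
      |t - t'| ≤ δ → |x - x'| ≤ δ → |duhamel T green F t x - duhamel T green F t' x'| ≤ ε := by
  -- The absolute value is taken because R is not assumed nonnegative here, and the summand 1 keeps
  -- the denominator positive.
  obtain ⟨δ, hδ, h⟩ := exists_hasL2Bound_green_sub (show 0 < ε / (√T * |R| + 1) by positivity)
  refine ⟨δ, hδ, fun F hF t x t' x' ht hx => ?_⟩
  have h1 := abs_duhamel_sub_le isKernel_green isKernel_green hT (t := t) (x := x) (t' := t')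
    (x' := x') (show 0 ≤ ε / (√T * |R| + 1) by positivity) (fun s _ => h _ _ _ _
      ((abs_max_sub_max_le_abs _ _ _).trans (by rwa [sub_sub_sub_cancel_right])) hx) hF
  refine h1.trans ?_
  rw [mul_assoc, div_mul_eq_mul_div, div_le_iff₀ (by positivity)]
  have : √T * R ≤ √T * |R| := by gcongr; exact le_abs_self R
  nlinarith

lemma continuous_duhamel_green (hT : 0 ≤ T) {F : ℝ × ℝ → ℝ} {R : ℝ}
    (hF : HasL2Bound (spaceTimeMeasure T) F R) :
    Continuous fun p : ℝ × ℝ => duhamel T green F p.1 p.2 := by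
  rw [Metric.continuous_iff]
  intro p ε hε
  obtain ⟨δ, hδ, h⟩ := exists_abs_duhamel_green_sub_le hT R (half_pos hε)
  refine ⟨δ, hδ, fun q hq => ?_⟩
  have hq' := hq.le
  rw [Prod.dist_eq, max_le_iff] at hq'
  exact (h F hF _ _ _ _ hq'.1 hq'.2).trans_lt (half_lt_self hε)

lemma continuous_discGreen (n : ℕ) (z : ℝ) :
    Continuous fun p : ℝ × ℝ => discGreen n p.1 p.2 z := by
  simp_rw [discGreen_eq_sum]
  exact continuous_finsetSum _ fun j _ => (continuous_discWaveCoeff n j).mul continuous_const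

lemma continuous_duhamel_discGreen (n : ℕ) {F : ℝ × ℝ → ℝ} {R : ℝ}
    (hF : HasL2Bound (spaceTimeMeasure T) F R) :
    Continuous fun p : ℝ × ℝ => duhamel T (discGreen n) F p.1 p.2 := by
  set C := ∑ j ∈ Finset.Icc 1 (n - 1), 1 / (j : ℝ) * √2
  refine continuous_of_dominated (bound := fun q => C * ‖F q‖) (fun p => ?_)
    (fun p => ae_of_all _ fun q => ?_) ?_ (ae_of_all _ fun q => ?_)
  · exact ((isKernel_discGreen n).measurable_shift p.1 p.2).aestronglyMeasurable.mul hF.aesm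
  · rw [norm_mul]
    gcongr
    exact abs_discGreen_le n _ _ _
  · exact (hF.memLp.integrable one_le_two).norm.const_mul C
  · have h : Continuous fun p : ℝ × ℝ => (max (p.1 - q.1) 0, p.2) := by fun_prop
    exact ((continuous_discGreen n q.2).comp h).mul continuous_const

end Kernel

/-! ### Sources, and recovery of a control from a source -/

section Drift

variable {T L B M : ℝ} {b σ : ℝ → ℝ}

lemma continuous_of_abs_sub_le {g : ℝ → ℝ} (hg : ∀ x y, |g x - g y| ≤ L * |x - y|) :
    Continuous g := by
  refine (LipschitzWith.of_dist_le_mul (K := L.toNNReal) fun x y => ?_).continuous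
  rw [Real.dist_eq, Real.dist_eq]
  exact (hg x y).trans (by gcongr; exact Real.le_coe_toNNReal L)

lemma abs_le_of_abs_sub_le {g : ℝ → ℝ} (hg : ∀ x y, |g x - g y| ≤ L * |x - y|)
    (hB : |g 0| ≤ B) (x : ℝ) : |g x| ≤ B + L * |x| := by
  have h1 := hg x 0
  rw [sub_zero] at h1
  have h2 := abs_add_le (g x - g 0) (g 0)
  rw [sub_add_cancel] at h2
  linarith

lemma control_hasL2Bound (h : Control T) : HasL2Bound (spaceTimeMeasure T) h ‖h‖ :=
  ⟨Lp.aestronglyMeasurable h, norm_nonneg h, by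
    rw [Lp.norm_def, ENNReal.ofReal_toReal (Lp.eLpNorm_ne_top h)]⟩

lemma control_hasL2Bound_one_add_abs (h : Control T) : HasL2Bound (spaceTimeMeasure T)
    (fun p => 1 + |h p|) (√((spaceTimeMeasure T).real univ) + ‖h‖) := by
  have h1 : HasL2Bound (spaceTimeMeasure T) (fun _ => (1 : ℝ))
      (1 * √((spaceTimeMeasure T).real univ)) :=
    .of_abs_le zero_le_one aestronglyMeasurable_const (ae_of_all _ fun _ => by simp)
  have h2 : HasL2Bound (spaceTimeMeasure T) (fun p => |h p|) (1 * ‖h‖) :=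
    (control_hasL2Bound h).of_abs_le_mul zero_le_one (Lp.aestronglyMeasurable h).norm
      (ae_of_all _ fun _ => by simp)
  simpa using h1.add h2

lemma abs_drift_le (hb : ∀ x y, |b x - b y| ≤ L * |x - y|)
    (hσ : ∀ x y, |σ x - σ y| ≤ L * |x - y|) (hB : |b 0| ≤ B) (hB' : |σ 0| ≤ B) (x k : ℝ) :
    |b x + σ x * k| ≤ (B + L * |x|) * (1 + |k|) := by
  have h1 := abs_le_of_abs_sub_le hb hB x
  have h2 := abs_le_of_abs_sub_le hσ hB' x
  refine (abs_add_le _ _).trans ?_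
  rw [abs_mul]
  nlinarith [abs_nonneg k]

lemma hasL2Bound_drift (hL : 0 ≤ L) (hb : ∀ x y, |b x - b y| ≤ L * |x - y|)
    (hσ : ∀ x y, |σ x - σ y| ≤ L * |x - y|) (hB : |b 0| ≤ B) (hB' : |σ 0| ≤ B)
    {q : ℝ × ℝ → ℝ} (hqm : AEStronglyMeasurable q (spaceTimeMeasure T)) (hM : 0 ≤ M)
    (hq : ∀ p ∈ spaceTime T, |q p| ≤ M) (h : Control T) :
    HasL2Bound (spaceTimeMeasure T) (fun p => b (q p) + σ (q p) * h p)
      ((B + L * M) * (√((spaceTimeMeasure T).real univ) + ‖h‖)) := by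
  have hB0 : 0 ≤ B := (abs_nonneg _).trans hB
  refine (control_hasL2Bound_one_add_abs h).of_abs_le_mul (by positivity) ?_ ?_
  · exact ((continuous_of_abs_sub_le hb).comp_aestronglyMeasurable hqm).add
      (((continuous_of_abs_sub_le hσ).comp_aestronglyMeasurable hqm).mul
        (Lp.aestronglyMeasurable h))
  · filter_upwards [ae_restrict_mem (measurableSet_spaceTime T)] with p hp
    rw [abs_of_nonneg (show 0 ≤ 1 + |h p| by positivity)]
    refine (abs_drift_le hb hσ hB hB' _ _).trans ?_
    gcongr
    exact hq p hp

lemma hasL2Bound_coeff_mul (hσ : ∀ x y, |σ x - σ y| ≤ L * |x - y|) {q : ℝ × ℝ → ℝ}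
    (hL : 0 ≤ L) (hqm : AEStronglyMeasurable q (spaceTimeMeasure T)) (hM : 0 ≤ M)
    (hq : ∀ p ∈ spaceTime T, |q p| ≤ M) {g : ℝ × ℝ → ℝ} {R : ℝ}
    (hg : HasL2Bound (spaceTimeMeasure T) g R) :
    HasL2Bound (spaceTimeMeasure T) (fun p => σ (q p) * g p) ((|σ 0| + L * M) * R) := by
  refine hg.of_abs_le_mul (by positivity)
    (((continuous_of_abs_sub_le hσ).comp_aestronglyMeasurable hqm).mul hg.aesm) ?_
  filter_upwards [ae_restrict_mem (measurableSet_spaceTime T)] with p hp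
  rw [abs_mul]
  gcongr
  refine (abs_le_of_abs_sub_le hσ le_rfl _).trans ?_
  gcongr
  exact hq p hp

/-- A control that reproduces a given source along a nearby path. -/
lemma exists_control (hb : ∀ x y, |b x - b y| ≤ L * |x - y|)
    (hσ : ∀ x y, |σ x - σ y| ≤ L * |x - y|) (hL : 0 ≤ L) {q₁ q₂ : ℝ × ℝ → ℝ}
    (hq₁ : AEStronglyMeasurable q₁ (spaceTimeMeasure T))
    (hq₂ : AEStronglyMeasurable q₂ (spaceTimeMeasure T)) {η : ℝ} (hη : 0 ≤ η)
    (hq : ∀ p ∈ spaceTime T, |q₁ p - q₂ p| ≤ η) {m : ℝ} (hm : 0 < m)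
    (hmσ : ∀ p ∈ spaceTime T, m ≤ |σ (q₂ p)|) (h : Control T) {ψ : ℝ × ℝ → ℝ} {C : ℝ}
    (hψ : HasL2Bound (spaceTimeMeasure T) ψ C) (d : ℝ) :
    ∃ h' : Control T,
      ‖h' - h‖ ≤ 1 / m * (L * η * (√((spaceTimeMeasure T).real univ) + ‖h‖) + |d| * C) ∧
      (fun p => b (q₂ p) + σ (q₂ p) * h' p)
        =ᵐ[spaceTimeMeasure T] fun p => b (q₁ p) + σ (q₁ p) * h p + d * ψ p := by
  have hbc := continuous_of_abs_sub_le hb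
  have hσc := continuous_of_abs_sub_le hσ
  have hmem := ae_restrict_mem (μ := volume) (measurableSet_spaceTime T)
  have h1 : HasL2Bound (spaceTimeMeasure T)
      (fun p => (b (q₁ p) - b (q₂ p)) + (σ (q₁ p) - σ (q₂ p)) * h p)
      (L * η * (√((spaceTimeMeasure T).real univ) + ‖h‖)) := by
    refine (control_hasL2Bound_one_add_abs h).of_abs_le_mul (by positivity)
      (((hbc.comp_aestronglyMeasurable hq₁).sub (hbc.comp_aestronglyMeasurable hq₂)).add
        (((hσc.comp_aestronglyMeasurable hq₁).sub (hσc.comp_aestronglyMeasurable hq₂)).mul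
          (Lp.aestronglyMeasurable h))) ?_
    filter_upwards [hmem] with p hp
    rw [abs_of_nonneg (show 0 ≤ 1 + |h p| by positivity)]
    have e : L * |q₁ p - q₂ p| ≤ L * η := by gcongr; exact hq p hp
    have e1 := (hb (q₁ p) (q₂ p)).trans e
    have e2 := (hσ (q₁ p) (q₂ p)).trans e
    refine (abs_add_le _ _).trans ?_
    rw [abs_mul]
    nlinarith [abs_nonneg (h p)]
  have h2 : HasL2Bound (spaceTimeMeasure T) (fun p => d * ψ p) (|d| * C) :=
    hψ.of_abs_le_mul (abs_nonneg d) (hψ.aesm.const_mul d) (ae_of_all _ fun p => by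
      rw [abs_mul])
  have h3 := h1.add h2
  -- N is what the source along q₂ with the old control h lacks. The new control is therefore h +
  -- N/σ(q₂).
  set N : ℝ × ℝ → ℝ := fun p => b (q₁ p) - b (q₂ p) + (σ (q₁ p) - σ (q₂ p)) * h p + d * ψ p
  have h4 : HasL2Bound (spaceTimeMeasure T) (fun p => N p / σ (q₂ p)) _ :=
    h3.of_abs_le_mul (show 0 ≤ 1 / m by positivity)
      (h3.aesm.aemeasurable.div
        (hσc.comp_aestronglyMeasurable hq₂).aemeasurable).aestronglyMeasurable (by
        filter_upwards [hmem] with p hp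
        rw [abs_div, div_eq_mul_one_div, mul_comm]
        gcongr
        exact hmσ p hp)
  refine ⟨h + h4.memLp.toLp _, ?_, ?_⟩
  · rw [add_sub_cancel_left, Lp.norm_toLp]
    exact ENNReal.toReal_le_of_le_ofReal h4.nonneg h4.le
  · filter_upwards [hmem, Lp.coeFn_add h (h4.memLp.toLp _), h4.memLp.coeFn_toLp] with p hp e1 e2
    have hσ0 : σ (q₂ p) ≠ 0 := abs_pos.1 (hm.trans_le (hmσ p hp))
    rw [e1, Pi.add_apply, e2, mul_add, mul_div_cancel₀ _ hσ0]
    ring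

end Drift

/-! ### The skeleton equation in Duhamel form and its a priori bound -/

section Path

variable {T : ℝ} {f : ℝ × ℝ → ℝ} {π : ℝ → ℝ}

lemma aestronglyMeasurable_comp_proj (hf : ContinuousOn f (spaceTime T)) (hπ : Measurable π)
    (hmaps : MapsTo π (Icc 0 1) (Icc 0 1)) :
    AEStronglyMeasurable (fun p : ℝ × ℝ => f (p.1, π p.2)) (spaceTimeMeasure T) := by
  have hm := measurable_indicator_of_continuousOn hf (measurableSet_spaceTime T)
  have hp : Measurable fun p : ℝ × ℝ => (p.1, π p.2) :=
    measurable_fst.prodMk (hπ.comp measurable_snd)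
  refine (hm.comp hp).aestronglyMeasurable.congr ?_
  filter_upwards [ae_restrict_mem (measurableSet_spaceTime T)] with p hp
  exact indicator_of_mem (show (p.1, π p.2) ∈ spaceTime T from ⟨hp.1, hmaps hp.2⟩) f

/-- The skeleton equation with kernel `G`, initial part `w` and grid projection `π`. -/
def SolvesSkeleton (T : ℝ) (G : ℝ → ℝ → ℝ → ℝ) (w : ℝ → ℝ → ℝ) (π b σ : ℝ → ℝ) (h : Control T)
    (f : ℝ × ℝ → ℝ) : Prop :=
  ∀ t ∈ Icc 0 T, ∀ x ∈ Icc (0 : ℝ) 1, f (t, x)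
    = w t x + duhamel T G (fun p => b (f (p.1, π p.2)) + σ (f (p.1, π p.2)) * h p) t x

variable {L : ℝ} {b σ : ℝ → ℝ} {G : ℝ → ℝ → ℝ → ℝ} {w : ℝ → ℝ → ℝ}

lemma exists_abs_le_of_continuousOn (hf : ContinuousOn f (spaceTime T)) :
    ∃ M, 0 ≤ M ∧ ∀ p ∈ spaceTime T, |f p| ≤ M := by
  obtain ⟨M, hM⟩ := (isCompact_spaceTime T).exists_bound_of_continuousOn hf
  exact ⟨|M|, abs_nonneg M, fun p hp => (hM p hp).trans (le_abs_self M)⟩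

lemma add_setIntegral_eq_duhamel_path (hT : 0 ≤ T) (hL : 0 ≤ L)
    (hb : ∀ x y, |b x - b y| ≤ L * |x - y|)
    (hσ : ∀ x y, |σ x - σ y| ≤ L * |x - y|) (hG : IsKernel G) (hπ : Measurable π)
    (hmaps : MapsTo π (Icc 0 1) (Icc 0 1)) (hf : ContinuousOn f (spaceTime T)) (h : Control T)
    {t : ℝ} (ht : t ∈ Icc 0 T) (x : ℝ) :
    (∫ p in Icc 0 t ×ˢ Icc (0 : ℝ) 1, G (t - p.1) x p.2 * b (f (p.1, π p.2)))
      + ∫ p in Icc 0 t ×ˢ Icc (0 : ℝ) 1, G (t - p.1) x p.2 * σ (f (p.1, π p.2)) * h p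
      = duhamel T G (fun p => b (f (p.1, π p.2)) + σ (f (p.1, π p.2)) * h p) t x := by
  obtain ⟨M, hM0, hM⟩ := exists_abs_le_of_continuousOn hf
  have hqm := aestronglyMeasurable_comp_proj hf hπ hmaps
  have hq : ∀ p ∈ spaceTime T, |f (p.1, π p.2)| ≤ M := fun p hp => hM _ ⟨hp.1, hmaps hp.2⟩
  have h1 : HasL2Bound (spaceTimeMeasure T) (fun _ => (1 : ℝ))
      (1 * √((spaceTimeMeasure T).real univ)) :=
    .of_abs_le zero_le_one aestronglyMeasurable_const (ae_of_all _ fun _ => by simp)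
  have hA := hasL2Bound_coeff_mul hb hL hqm hM0 hq h1
  simp_rw [mul_one] at hA
  exact hG.add_setIntegral_eq_duhamel hT hA
    (hasL2Bound_coeff_mul hσ hL hqm hM0 hq (control_hasL2Bound h)) ht x

lemma isSkeleton_iff (hT : 0 ≤ T) (hL : 0 ≤ L) (hb : ∀ x y, |b x - b y| ≤ L * |x - y|)
    (hσ : ∀ x y, |σ x - σ y| ≤ L * |x - y|) (hf : ContinuousOn f (spaceTime T)) (u v : ℝ → ℝ)
    (h : Control T) : IsSkeleton T u v b σ h f
      ↔ SolvesSkeleton T green (initialPart u v) id b σ h f := by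
  refine forall₂_congr fun t ht => forall₂_congr fun x _ => ?_
  rw [← add_setIntegral_eq_duhamel_path hT hL hb hσ isKernel_green measurable_id (mapsTo_id _) hf h
    ht x, initialPart, add_assoc _ (∫ p in _ ×ˢ _, _)]
  rfl

lemma isDiscSkeleton_iff {n : ℕ} (hn : 0 < n) (hT : 0 ≤ T) (hL : 0 ≤ L)
    (hb : ∀ x y, |b x - b y| ≤ L * |x - y|) (hσ : ∀ x y, |σ x - σ y| ≤ L * |x - y|)
    (hf : ContinuousOn f (spaceTime T)) (u v : ℝ → ℝ) (h : Control T) :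
    IsDiscSkeleton n T u v b σ h f
      ↔ SolvesSkeleton T (discGreen n) (discInitialPart n u v) (kappa n) b σ h f := by
  refine forall₂_congr fun t ht => forall₂_congr fun x _ => ?_
  rw [← add_setIntegral_eq_duhamel_path hT hL hb hσ (isKernel_discGreen n) (measurable_kappa n)
    (fun z => kappa_mem hn) hf h ht x, discInitialPart, add_assoc _ (∫ p in _ ×ˢ _, _)]

/-- A bound for the solutions of the skeleton equation that depends on the control only through
its norm. -/
lemma exists_abs_le_of_solvesSkeleton (hT : 0 ≤ T) (hL : 0 ≤ L)
    (hb : ∀ x y, |b x - b y| ≤ L * |x - y|) (hσ : ∀ x y, |σ x - σ y| ≤ L * |x - y|) (W a : ℝ)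
    (hW : 0 ≤ W) (ha : 0 ≤ a) :
    ∃ M, 0 ≤ M ∧ ∀ (G : ℝ → ℝ → ℝ → ℝ) (w : ℝ → ℝ → ℝ) (π : ℝ → ℝ) (h : Control T)
      (f : ℝ × ℝ → ℝ), IsKernel G → (∀ t ∈ Icc 0 T, ∀ x ∈ Icc (0 : ℝ) 1, |w t x| ≤ W) →
      Measurable π → MapsTo π (Icc 0 1) (Icc 0 1) → ‖h‖ ≤ a → ContinuousOn f (spaceTime T) →
      SolvesSkeleton T G w π b σ h f → ∀ p ∈ spaceTime T, |f p| ≤ M := by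
  set A := √((spaceTimeMeasure T).real univ) + a with hA
  set B := max |b 0| |σ 0| with hB
  have hA0 : 0 ≤ A := by positivity
  have hB0 : 0 ≤ B := (abs_nonneg _).trans (le_max_left _ _)
  -- Chosen so that √(2l) = 4AL + 1. The factor of M on the right of the weighted estimate is then
  -- 2AL/(4AL + 1) ≤ 1/2 and can be absorbed.
  set l := (4 * A * L + 1) ^ 2 / 2 with hl
  have hl0 : 0 < l := by positivity
  have hsq : √(2 * l) = 4 * A * L + 1 := by
    rw [hl, mul_div_cancel₀ _ two_ne_zero, Real.sqrt_sq (by positivity)]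
  refine ⟨Real.exp (l * T) * (2 * W + 4 * A * B), by positivity, ?_⟩
  intro G w π h f hG hw hπ hmaps hh hf hsol
  have hne : (spaceTime T).Nonempty := ⟨(0, 0), ⟨⟨le_rfl, hT⟩, by simp⟩⟩
  -- A maximum of the weighted path e^{-lt}|f| replaces Gronwall's lemma: the equation is used only
  -- at p₀.
  obtain ⟨p₀, hp₀, hmax⟩ := (isCompact_spaceTime T).exists_isMaxOn hne
    (f := fun p => Real.exp (-(l * p.1)) * |f p|)
    (((by fun_prop : Continuous fun p : ℝ × ℝ => Real.exp (-(l * p.1))).continuousOn).mul hf.abs)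
  set M := Real.exp (-(l * p₀.1)) * |f p₀| with hM
  have hM0 : 0 ≤ M := by positivity
  have hfM : ∀ p ∈ spaceTime T, |f p| ≤ M * Real.exp (l * p.1) := fun p hp => by
    have h1 : Real.exp (-(l * p.1)) * |f p| ≤ M := hmax hp
    have h2 := mul_le_mul_of_nonneg_right h1 (Real.exp_nonneg (l * p.1))
    rwa [mul_right_comm, ← Real.exp_add, neg_add_cancel, Real.exp_zero, one_mul] at h2
  have hqm := aestronglyMeasurable_comp_proj hf hπ hmaps
  set F : ℝ × ℝ → ℝ := fun p => b (f (p.1, π p.2)) + σ (f (p.1, π p.2)) * h p with hF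
  have hFm : AEStronglyMeasurable F (spaceTimeMeasure T) :=
    ((continuous_of_abs_sub_le hb).comp_aestronglyMeasurable hqm).add
      (((continuous_of_abs_sub_le hσ).comp_aestronglyMeasurable hqm).mul
        (Lp.aestronglyMeasurable h))
  have hF' : HasL2Bound (spaceTimeMeasure T) (fun p => Real.exp (-(l * p.1)) * F p)
      ((B + L * M) * A) := by
    refine (((control_hasL2Bound_one_add_abs h).mono
      (show _ ≤ A by rw [hA]; gcongr)).of_abs_le_mul (by positivity) ?_ ?_)
    · exact (by fun_prop : Continuous fun p : ℝ × ℝ =>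
        Real.exp (-(l * p.1))).aestronglyMeasurable.mul hFm
    · filter_upwards [ae_restrict_mem (measurableSet_spaceTime T)] with p hp
      rw [abs_of_nonneg (show 0 ≤ 1 + |h p| by positivity), abs_mul, abs_of_pos (Real.exp_pos _)]
      have h1 := abs_drift_le hb hσ (le_max_left |b 0| |σ 0|) (le_max_right |b 0| |σ 0|)
        (f (p.1, π p.2)) (h p)
      have h2 : |f (p.1, π p.2)| ≤ M * Real.exp (l * p.1) := hfM _ ⟨hp.1, hmaps hp.2⟩
      have h3 : 1 ≤ Real.exp (l * p.1) := Real.one_le_exp (mul_nonneg hl0.le hp.1.1)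
      calc _ ≤ Real.exp (-(l * p.1)) * ((B * Real.exp (l * p.1)
              + L * (M * Real.exp (l * p.1))) * (1 + |h p|)) := by
            gcongr
            refine h1.trans ?_
            gcongr
            exact le_mul_of_one_le_right hB0 h3
        _ = (Real.exp (-(l * p.1)) * Real.exp (l * p.1)) * ((B + L * M) * (1 + |h p|)) := by ring
        _ = _ := by rw [← Real.exp_add, neg_add_cancel, Real.exp_zero, one_mul]
  -- The weight taken from the source is moved to the kernel, whose sections vanish for s > t. This
  -- produces e^{lt}/√(2l).
  have hK : ∀ t x, HasL2Bound (spaceTimeMeasure T)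
      (fun p => G (max (t - p.1) 0) x p.2 * Real.exp (l * p.1))
      (2 * Real.exp (l * t) / √(2 * l)) := fun t x => by
    have hm : Measurable fun p : ℝ × ℝ => G (max (t - p.1) 0) x p.2 * Real.exp (l * p.1) :=
      (hG.measurable_shift t x).mul (by fun_prop)
    refine .of_sections (c := fun s => if s ≤ t then 2 * Real.exp (l * s) else 0)
      hm (by positivity) (fun s _ => ?_) (lintegral_exp_weight_le hl0 2)
    have hb' := hG.bound (max (t - s) 0) x
    change HasL2Bound unitMeasure (fun z => G (max (t - s) 0) x z * Real.exp (l * s)) _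
    by_cases hs : s ≤ t
    · rw [if_pos hs, mul_comm 2]
      exact hb'.of_abs_le_mul (Real.exp_nonneg _) (hb'.aesm.mul_const _)
        (ae_of_all _ fun z => by rw [abs_mul, Real.abs_exp, mul_comm])
    · rw [if_neg hs, max_eq_right (by linarith)]
      simp only [hG.zero, zero_mul]
      simpa using HasL2Bound.of_abs_le_unit (f := fun _ => (0 : ℝ)) le_rfl
        aestronglyMeasurable_const (by simp)
  have hd : ∀ t x, |duhamel T G F t x|
      ≤ 2 * Real.exp (l * t) / √(2 * l) * ((B + L * M) * A) := fun t x => by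
    refine le_trans (le_of_eq ?_) (abs_integral_mul_le (hK t x) hF')
    congr 1
    refine integral_congr_ae (ae_of_all _ fun p => ?_)
    have : Real.exp (l * p.1) * Real.exp (-(l * p.1)) = 1 := by
      rw [← Real.exp_add, add_neg_cancel, Real.exp_zero]
    linear_combination (-(G (max (t - p.1) 0) x p.2 * F p)) * this
  have hMle : M ≤ 2 * W + 4 * A * B := by
    have h1 := hsol p₀.1 hp₀.1 p₀.2 hp₀.2
    have h2 := (abs_add_le (w p₀.1 p₀.2) (duhamel T G F p₀.1 p₀.2)).trans
      (add_le_add (hw p₀.1 hp₀.1 p₀.2 hp₀.2) (hd p₀.1 p₀.2))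
    have h1' : f p₀ = w p₀.1 p₀.2 + duhamel T G F p₀.1 p₀.2 := h1
    rw [← h1'] at h2
    have h3 : Real.exp (-(l * p₀.1)) ≤ 1 := by
      rw [Real.exp_le_one_iff]
      exact neg_nonpos.2 (mul_nonneg hl0.le hp₀.1.1)
    have h4 : M ≤ W + 2 / (4 * A * L + 1) * ((B + L * M) * A) := by
      calc M ≤ Real.exp (-(l * p₀.1)) * (W + 2 * Real.exp (l * p₀.1) / √(2 * l)
            * ((B + L * M) * A)) := by rw [hM]; gcongr
        _ = Real.exp (-(l * p₀.1)) * W + (Real.exp (-(l * p₀.1)) * Real.exp (l * p₀.1))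
            * (2 / (4 * A * L + 1) * ((B + L * M) * A)) := by rw [hsq]; ring
        _ ≤ 1 * W + 1 * (2 / (4 * A * L + 1) * ((B + L * M) * A)) := by
            rw [← Real.exp_add, neg_add_cancel, Real.exp_zero]; gcongr
        _ = _ := by ring
    have h5 : 2 / (4 * A * L + 1) * ((B + L * M) * A) ≤ 2 * A * B + M / 2 := by
      rw [div_mul_eq_mul_div, div_le_iff₀ (by positivity)]
      have e1 : 0 ≤ A * L * (A * B) := by positivity
      nlinarith
    linarith
  intro p hp
  calc |f p| ≤ M * Real.exp (l * p.1) := hfM p hp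
    _ ≤ (2 * W + 4 * A * B) * Real.exp (l * T) := by
        gcongr
        exact hp.1.2
    _ = _ := mul_comm _ _

end Path

/-! ### Transfer of a path with corrected end value -/

section Perturbation

/-- The source that is used to correct the value of a path at the final time. -/
def testSource (T : ℝ) (p : ℝ × ℝ) : ℝ := Real.sin (Real.pi * (T - p.1)) * phi 1 p.2

lemma hasL2Bound_testSource (T : ℝ) : HasL2Bound (spaceTimeMeasure T) (testSource T)
    (√2 * √((spaceTimeMeasure T).real univ)) := by
  have hc : Continuous (testSource T) := by unfold testSource; fun_prop
  refine .of_abs_le (Real.sqrt_nonneg 2) hc.aestronglyMeasurable (ae_of_all _ fun p => ?_)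
  rw [testSource, abs_mul]
  calc _ ≤ 1 * √2 := mul_le_mul (Real.abs_sin_le_one _) (abs_phi_le _ _) (abs_nonneg _) zero_le_one
    _ = √2 := one_mul _

/-- The sine expansion of φ_1 has a single term. -/
lemma integral_green_mul_phi_one (t x : ℝ) :
    ∫ z, green t x z * phi 1 z ∂unitMeasure = waveCoeff 1 t x := by
  have hsmooth : ContDiff ℝ 2 (phi 1) := by unfold phi; fun_prop
  have h := hasSum_integral_green_mul hsmooth.contDiffOn (by simp [phi]) (by simp [phi]) t x
  have h1 : sineCoeff (phi 1) 1 = 1 := by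
    rw [sineCoeff, integral_phi_mul le_rfl le_rfl, if_pos rfl]
  have h2 := hasSum_single (f := fun j => waveCoeff j t x * sineCoeff (phi 1) j) 1 fun j hj => by
    rcases Nat.eq_zero_or_pos j with rfl | hj0
    · simp [waveCoeff]
    · rw [sineCoeff, integral_phi_mul hj0 le_rfl, if_neg hj, mul_zero]
  rw [h.unique h2, h1, mul_one]

/-- The test source excites only the first mode, with the time profile of the kernel itself, so the
response is the integral of sin²(π(T - s)) times φ_1(x₀)/π. It is positive since x₀ is interior. -/
lemma duhamel_green_testSource_pos {T x₀ : ℝ} (hT : 0 < T) (hx₀ : x₀ ∈ Ioo (0 : ℝ) 1) :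
    0 < duhamel T green (testSource T) T x₀ := by
  have hpi := Real.pi_pos
  have hint := isKernel_green.integrable_shift_mul hT.le (hasL2Bound_testSource T) T x₀
  have hphi : 0 < phi 1 x₀ := by
    refine mul_pos (by positivity) (Real.sin_pos_of_pos_of_lt_pi ?_ ?_)
    · have := hx₀.1
      push_cast; positivity
    · push_cast; nlinarith [hx₀.2]
  have h1 : duhamel T green (testSource T) T x₀
      = ∫ s in (0 : ℝ)..T, Real.sin (Real.pi * (T - s)) ^ 2 * (phi 1 x₀ / Real.pi) := by
    unfold duhamel
    rw [spaceTimeMeasure_eq_prod] at hint ⊢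
    rw [integral_prod _ hint, intervalIntegral.integral_of_le hT.le,
      ← integral_Icc_eq_integral_Ioc]
    refine setIntegral_congr_fun measurableSet_Icc fun s hs => ?_
    have e : ∀ z, green (max (T - s) 0) x₀ z * testSource T (s, z)
        = Real.sin (Real.pi * (T - s)) * (green (max (T - s) 0) x₀ z * phi 1 z) := fun z => by
      rw [testSource]; ring
    simp only [e]
    rw [integral_const_mul, integral_green_mul_phi_one, max_eq_left (sub_nonneg.2 hs.2), waveCoeff]
    push_cast
    rw [one_mul]; ring
  rw [h1]
  refine intervalIntegral.integral_pos hT (by fun_prop) (fun s _ => by positivity)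
    -- At this time T - s lies in (0, 1/2], where sin(π(T - s)) > 0.
    ⟨T - min T (1 / 2), ⟨by simp, by simp; positivity⟩, ?_⟩
  rw [sub_sub_cancel]
  have h2 : 0 < min T (1 / 2) := lt_min hT (by norm_num)
  have h3 : min T (1 / 2) ≤ 1 / 2 := min_le_right _ _
  have h4 : 0 < Real.sin (Real.pi * min T (1 / 2)) :=
    Real.sin_pos_of_pos_of_lt_pi (by positivity) (by nlinarith)
  positivity

lemma eventually_le_abs_duhamel_discGreen {T x : ℝ} (hT : 0 ≤ T) {F : ℝ × ℝ → ℝ} {R : ℝ}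
    (hF : HasL2Bound (spaceTimeMeasure T) F R) (hpos : 0 < duhamel T green F T x) :
    ∀ᶠ n in atTop, duhamel T green F T x / 2 ≤ |duhamel T (discGreen n) F T x| := by
  set c := duhamel T green F T x
  have hR := hF.nonneg
  filter_upwards [eventually_hasL2Bound_discGreen_sub T
    (show 0 < c / 2 / (√T * R + 1) by positivity)] with n hn
  have h1 := abs_duhamel_sub_le (isKernel_discGreen n) isKernel_green hT (t := T) (x := x)
    (t' := T) (x' := x) (show 0 ≤ c / 2 / (√T * R + 1) by positivity) (fun s hs => hn _
      ⟨le_max_right _ _, max_le (by linarith [hs.1]) hT⟩ x) hF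
  have h2 : c / 2 / (√T * R + 1) * √T * R ≤ c / 2 := by
    rw [mul_assoc, div_mul_eq_mul_div, div_le_iff₀ (by positivity)]
    nlinarith
  have h3 := (abs_le.1 (h1.trans h2)).1
  have h4 := le_abs_self (duhamel T (discGreen n) F T x)
  change -(c / 2) ≤ _ - c at h3
  linarith

/-- Transfer of a path from one equation to another, corrected so that its value at `(T, x₀)` is
unchanged. -/
lemma exists_transfer_path {T R C c : ℝ} (hT : 0 ≤ T) (hR : 0 ≤ R) (hC : 0 ≤ C) (hc : 0 < c)
    {ε : ℝ} (hε : 0 < ε) : ∃ ε' > 0, ∀ (G₁ G₂ : ℝ → ℝ → ℝ → ℝ) (w₁ w₂ : ℝ → ℝ → ℝ)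
      (F ψ : ℝ × ℝ → ℝ) (x₀ : ℝ), IsKernel G₁ → IsKernel G₂ →
      (∀ t ∈ Icc 0 T, ∀ x, |w₂ t x - w₁ t x| ≤ ε') →
      (∀ t ∈ Icc 0 T, ∀ x, HasL2Bound unitMeasure (fun z => G₂ t x z - G₁ t x z) ε') →
      HasL2Bound (spaceTimeMeasure T) F R → HasL2Bound (spaceTimeMeasure T) ψ C →
      c ≤ |duhamel T G₂ ψ T x₀| →
      ∃ d, |d| ≤ ε ∧
        w₂ T x₀ + duhamel T G₂ (fun p => F p + d * ψ p) T x₀ = w₁ T x₀ + duhamel T G₁ F T x₀ ∧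
        ∀ t ∈ Icc 0 T, ∀ x, |w₂ t x + duhamel T G₂ (fun p => F p + d * ψ p) t x
          - (w₁ t x + duhamel T G₁ F t x)| ≤ ε := by
  set K := 1 + √T * R with hK
  set Q := 1 + 2 * √T * C with hQ
  have hK0 : 0 < K := by positivity
  have hQ0 : 1 ≤ Q := by rw [hQ]; linarith [show 0 ≤ 2 * √T * C by positivity]
  have hQ1 : 0 < Q := by linarith
  -- K turns ε' into the distance between the uncorrected paths, and Q accounts for the path error
  -- together with the response to dψ. The factor c/(c + 1) makes both ε'K and ε'K/c at most ε/Q.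
  refine ⟨min (ε * c / (K * Q)) (ε / Q * (c / (c + 1)) / K), by positivity, ?_⟩
  set ε' := min (ε * c / (K * Q)) (ε / Q * (c / (c + 1)) / K) with hε'
  have hε'0 : 0 < ε' := by positivity
  have hle : ε' * K ≤ ε / Q * (c / (c + 1)) := by
    rw [← le_div_iff₀ hK0]; exact min_le_right _ _
  have hle1 : ε' * K / c ≤ ε / Q / (c + 1) := by
    rw [div_le_iff₀ hc]; exact hle.trans (le_of_eq (by ring))
  have hle2 : ε / Q / (c + 1) ≤ ε / Q := div_le_self (by positivity) (by linarith)
  have hle3 : ε / Q ≤ ε := div_le_self hε.le hQ0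
  intro G₁ G₂ w₁ w₂ F ψ x₀ hG₁ hG₂ hw hG hF hψ hcle
  have hne : duhamel T G₂ ψ T x₀ ≠ 0 := abs_pos.1 (hc.trans_le hcle)
  have hclose : ∀ t ∈ Icc 0 T, ∀ x,
      |w₂ t x + duhamel T G₂ F t x - (w₁ t x + duhamel T G₁ F t x)| ≤ ε' * K := by
    intro t ht x
    have h1 := abs_duhamel_sub_le hG₂ hG₁ hT (t := t) (x := x) (t' := t) (x' := x) hε'0.le
      (fun s hs => hG _ ⟨le_max_right _ _, max_le (by linarith [hs.1, ht.2]) hT⟩ x) hF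
    rw [add_sub_add_comm]
    refine (abs_add_le _ _).trans ((add_le_add (hw t ht x) h1).trans (le_of_eq ?_))
    rw [hK]; ring
  -- The response is linear in the source, so the defect at (T, x₀) divided by the response to ψ
  -- removes it exactly.
  set d := (w₁ T x₀ + duhamel T G₁ F T x₀ - (w₂ T x₀ + duhamel T G₂ F T x₀))
    / duhamel T G₂ ψ T x₀ with hd
  have hdle : |d| ≤ ε' * K / c := by
    rw [hd, abs_div, abs_sub_comm]
    gcongr
    exact hclose T ⟨hT, le_rfl⟩ x₀
  refine ⟨d, (hdle.trans hle1).trans (hle2.trans hle3), ?_, fun t ht x => ?_⟩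
  · rw [hG₂.duhamel_add_const_mul hT hF hψ, hd, div_mul_cancel₀ _ hne]; ring
  · rw [hG₂.duhamel_add_const_mul hT hF hψ, ← add_assoc, add_sub_right_comm]
    refine (abs_add_le _ _).trans ?_
    rw [abs_mul]
    have h1 := hclose t ht x
    have h2 : |d| * |duhamel T G₂ ψ t x| ≤ ε / Q / (c + 1) * (2 * √T * C) :=
      mul_le_mul (hdle.trans hle1) (hG₂.abs_duhamel_le hT hψ t x) (abs_nonneg _) (by positivity)
    have h3 : ε / Q / (c + 1) * (2 * √T * C) ≤ ε / Q * (2 * √T * C) := by gcongr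
    have h4 : ε' * K ≤ ε / Q := hle.trans (mul_le_of_le_one_right (by positivity)
      ((div_le_one (by positivity)).2 (by linarith)))
    have h5 : ε / Q + ε / Q * (2 * √T * C) = ε := by
      rw [← mul_one_add, ← hQ, div_mul_cancel₀ _ hQ1.ne']
    linarith

/-- Since η ≤ 1, the path q₂ stays in [-(M + 1), M + 1], where |σ| has a positive minimum. One η
thus serves all paths bounded by M and all controls of norm at most a. -/
lemma exists_control_uniform {T L : ℝ} {b σ : ℝ → ℝ} (hL : 0 ≤ L)
    (hb : ∀ x y, |b x - b y| ≤ L * |x - y|) (hσ : ∀ x y, |σ x - σ y| ≤ L * |x - y|)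
    (hσ0 : ∀ x, σ x ≠ 0) (M : ℝ) {a C : ℝ} (ha : 0 ≤ a) (hC : 0 ≤ C) {ε : ℝ} (hε : 0 < ε) :
    ∃ η > 0, η ≤ 1 ∧ ∀ (q₁ q₂ ψ : ℝ × ℝ → ℝ) (h : Control T) (d : ℝ),
      AEStronglyMeasurable q₁ (spaceTimeMeasure T) →
      AEStronglyMeasurable q₂ (spaceTimeMeasure T) →
      (∀ p ∈ spaceTime T, |q₁ p| ≤ M) → (∀ p ∈ spaceTime T, |q₁ p - q₂ p| ≤ η) →
      HasL2Bound (spaceTimeMeasure T) ψ C → ‖h‖ ≤ a → |d| ≤ η →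
      ∃ h' : Control T, ‖h' - h‖ ≤ ε ∧ (fun p => b (q₂ p) + σ (q₂ p) * h' p)
        =ᵐ[spaceTimeMeasure T] fun p => b (q₁ p) + σ (q₁ p) * h p + d * ψ p := by
  have hpos : ∃ m > 0, ∀ x ∈ Icc (-(M + 1)) (M + 1), m ≤ |σ x| := by
    -- M is not assumed nonnegative, so the interval may be empty and any m works then.
    rcases (Icc (-(M + 1)) (M + 1)).eq_empty_or_nonempty with hemp | hne
    · exact ⟨1, one_pos, fun x hx => absurd hx (by rw [hemp]; exact notMem_empty x)⟩
    obtain ⟨x, hx, hmin⟩ := isCompact_Icc.exists_isMinOn hne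
      (continuous_of_abs_sub_le hσ).abs.continuousOn
    exact ⟨|σ x|, abs_pos.2 (hσ0 x), fun y hy => hmin hy⟩
  obtain ⟨m, hm, hmσ⟩ := hpos
  set A := √((spaceTimeMeasure T).real univ) + a with hA
  have hA0 : 0 ≤ A := by positivity
  refine ⟨min 1 (ε * m / (L * A + C + 1)), by positivity, min_le_left _ _, ?_⟩
  set η := min 1 (ε * m / (L * A + C + 1)) with hη
  have hη0 : 0 < η := by positivity
  intro q₁ q₂ ψ h d hq₁ hq₂ hM hq hψ hh hd
  obtain ⟨h', h1, h2⟩ := exists_control hb hσ hL hq₁ hq₂ hη0.le hq hm (fun p hp => hmσ _ (by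
    have e1 := abs_le.1 (hM p hp)
    have e2 := abs_le.1 ((hq p hp).trans (min_le_left _ _))
    constructor <;> linarith [e1.1, e1.2, e2.1, e2.2])) h hψ d
  refine ⟨h', h1.trans ?_, h2⟩
  have h3 : η * (L * A + C + 1) ≤ ε * m := by
    rw [← le_div_iff₀ (by positivity)]; exact min_le_right _ _
  rw [one_div_mul_eq_div, div_le_iff₀ hm]
  calc L * η * (√((spaceTimeMeasure T).real univ) + ‖h‖) + |d| * C ≤ L * η * A + η * C := by
        rw [hA]; gcongr
    _ ≤ η * (L * A + C + 1) := by nlinarith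
    _ ≤ ε * m := h3

lemma eventually_abs_path_kappa_sub_le {T : ℝ} {f : ℝ × ℝ → ℝ} (hf : ContinuousOn f (spaceTime T))
    {ε : ℝ} (hε : 0 < ε) :
    ∀ᶠ n in atTop, ∀ p ∈ spaceTime T, |f (p.1, kappa n p.2) - f p| ≤ ε := by
  have huc := (isCompact_spaceTime T).uniformContinuousOn_of_continuous hf
  obtain ⟨δ, hδ, h⟩ := Metric.uniformContinuousOn_iff.1 huc ε hε
  filter_upwards [eventually_gt_atTop 0,
    (tendsto_one_div_atTop_nhds_zero_nat (𝕜 := ℝ)).eventually (gt_mem_nhds hδ)] with n hn hnδ p hp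
  have hκ : (p.1, kappa n p.2) ∈ spaceTime T := ⟨hp.1, kappa_mem hn hp.2⟩
  refine (h _ hκ p hp ?_).le
  rw [Prod.dist_eq, dist_self, Real.dist_eq]
  exact max_lt hδ ((abs_kappa_sub_le hn p.2).trans_lt hnδ)

end Perturbation

/-! ### Comparison of controls and convergence of the rate functions -/

section Rate

variable {T x₀ y L : ℝ} {u₀ v₀ b σ : ℝ → ℝ}

/-- A control of the continuous problem can be replaced by a nearby control of the discrete
problem without changing the value at `(T, x₀)`. -/
lemma eventually_exists_discSkeleton (hT : 0 < T) (hx₀ : x₀ ∈ Ioo (0 : ℝ) 1)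
    (hu : ContDiffOn ℝ 2 u₀ (Icc 0 1)) (hu0 : u₀ 0 = 0) (hu1 : u₀ 1 = 0)
    (hv : ContinuousOn v₀ (Icc 0 1)) (hL : 0 ≤ L) (hb : ∀ x y, |b x - b y| ≤ L * |x - y|)
    (hσ : ∀ x y, |σ x - σ y| ≤ L * |x - y|) (hσ0 : ∀ x, σ x ≠ 0) {f : ℝ × ℝ → ℝ} {h : Control T}
    (hf : ContinuousOn f (spaceTime T)) (hfy : f (T, x₀) = y)
    (hsol : IsSkeleton T u₀ v₀ b σ h f) {ε : ℝ} (hε : 0 < ε) :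
    ∀ᶠ n in atTop, ∃ (f' : ℝ × ℝ → ℝ) (h' : Control T), ContinuousOn f' (spaceTime T) ∧
      f' (T, x₀) = y ∧ IsDiscSkeleton n T u₀ v₀ b σ h' f' ∧ ‖h' - h‖ ≤ ε := by
  rw [isSkeleton_iff hT.le hL hb hσ hf] at hsol
  obtain ⟨M, hM0, hM⟩ := exists_abs_le_of_continuousOn hf
  have hψ := hasL2Bound_testSource T
  set C := √2 * √((spaceTimeMeasure T).real univ)
  obtain ⟨η, hη, -, hctrl⟩ := exists_control_uniform (T := T) hL hb hσ hσ0 M (norm_nonneg h)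
    hψ.nonneg hε
  have hqm := aestronglyMeasurable_comp_proj hf measurable_id (mapsTo_id _)
  have hF := hasL2Bound_drift hL hb hσ (le_max_left |b 0| |σ 0|) (le_max_right |b 0| |σ 0|)
    hqm hM0 hM h
  have hc := duhamel_green_testSource_pos hT hx₀
  obtain ⟨ε', hε', htrans⟩ := exists_transfer_path hT.le hF.nonneg hψ.nonneg (half_pos hc)
    (half_pos hη)
  filter_upwards [eventually_gt_atTop 0, eventually_hasL2Bound_discGreen_sub T hε',
    eventually_abs_discInitialPart_sub_le hu hu0 hu1 hv T hε',
    eventually_le_abs_duhamel_discGreen hT.le hψ hc,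
    eventually_abs_path_kappa_sub_le hf (half_pos hη)] with n hn hG hw hcn hκ
  obtain ⟨d, hd, hval, hclose⟩ := htrans green (discGreen n) (initialPart u₀ v₀)
    (discInitialPart n u₀ v₀) _ _ x₀ isKernel_green (isKernel_discGreen n) hw hG hF hψ hcn
  set F : ℝ × ℝ → ℝ := fun p => b (f (p.1, id p.2)) + σ (f (p.1, id p.2)) * h p with hFdef
  have hFd : HasL2Bound (spaceTimeMeasure T) (fun p => F p + d * testSource T p) _ :=
    hF.add (hψ.of_abs_le_mul (abs_nonneg d) (hψ.aesm.const_mul d)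
      (ae_of_all _ fun p => by rw [abs_mul]))
  set f' : ℝ × ℝ → ℝ := fun p => discInitialPart n u₀ v₀ p.1 p.2
    + duhamel T (discGreen n) (fun p => F p + d * testSource T p) p.1 p.2 with hf'
  have hf'c : ContinuousOn f' (spaceTime T) :=
    ((continuous_discInitialPart hn hu.continuousOn hv).add
      (continuous_duhamel_discGreen n hFd)).continuousOn
  have hmaps : MapsTo (kappa n) (Icc 0 1) (Icc 0 1) := fun z => kappa_mem hn
  have hdist : ∀ p ∈ spaceTime T, |f' p - f p| ≤ η / 2 := fun p hp => by
    have h1 := hclose p.1 hp.1 p.2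
    rwa [← hsol p.1 hp.1 p.2 hp.2] at h1
  -- The discrete coefficients see f' at grid points: one η/2 pays for f' - f there, the other for
  -- the oscillation of the fixed path f over a cell.
  obtain ⟨h', hh', hae⟩ := hctrl f (fun p => f' (p.1, kappa n p.2)) (testSource T) h d hqm
    (aestronglyMeasurable_comp_proj hf'c (measurable_kappa n) hmaps) hM (fun p hp => by
      have h1 := hdist (p.1, kappa n p.2) ⟨hp.1, hmaps hp.2⟩
      have h2 := hκ p hp
      rw [abs_sub_comm, ← sub_add_sub_cancel _ (f (p.1, kappa n p.2))]
      exact (abs_add_le _ _).trans (by linarith)) hψ le_rfl (hd.trans (by linarith))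
  refine ⟨f', h', hf'c, ?_, ?_, hh'⟩
  · rw [← hfy, hsol T ⟨hT.le, le_rfl⟩ x₀ (Ioo_subset_Icc_self hx₀)]
    exact hval
  · rw [isDiscSkeleton_iff hn hT.le hL hb hσ hf'c]
    intro t _ x _
    rw [duhamel_congr hae t x]
    rfl

/-- Controls of the discrete problem of bounded norm can be replaced by nearby controls of the
continuous problem without changing the value at `(T, x₀)`. -/
lemma eventually_exists_skeleton (hT : 0 < T) (hx₀ : x₀ ∈ Ioo (0 : ℝ) 1)
    (hu : ContDiffOn ℝ 2 u₀ (Icc 0 1)) (hu0 : u₀ 0 = 0) (hu1 : u₀ 1 = 0)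
    (hv : ContinuousOn v₀ (Icc 0 1)) (hL : 0 ≤ L) (hb : ∀ x y, |b x - b y| ≤ L * |x - y|)
    (hσ : ∀ x y, |σ x - σ y| ≤ L * |x - y|) (hσ0 : ∀ x, σ x ≠ 0) {a : ℝ} (ha : 0 ≤ a) {ε : ℝ}
    (hε : 0 < ε) :
    ∀ᶠ n in atTop, ∀ (f : ℝ × ℝ → ℝ) (h : Control T), ContinuousOn f (spaceTime T) →
      f (T, x₀) = y → IsDiscSkeleton n T u₀ v₀ b σ h f → ‖h‖ ≤ a →
      ∃ (f' : ℝ × ℝ → ℝ) (h' : Control T), ContinuousOn f' (spaceTime T) ∧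
        f' (T, x₀) = y ∧ IsSkeleton T u₀ v₀ b σ h' f' ∧ ‖h' - h‖ ≤ ε := by
  have hwc := continuous_initialPart hu hu0 hu1 hv
  obtain ⟨W, hW0, hW⟩ := exists_abs_le_of_continuousOn (hwc.continuousOn (s := spaceTime T))
  -- W + 1 also bounds the discrete initial parts once they are within 1 of the continuous one. M
  -- therefore depends neither on n nor on the control.
  obtain ⟨M, hM0, hM⟩ := exists_abs_le_of_solvesSkeleton hT.le hL hb hσ (W + 1) a (by positivity) ha
  have hψ := hasL2Bound_testSource T
  set C := √2 * √((spaceTimeMeasure T).real univ)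
  obtain ⟨η, hη, hη1, hctrl⟩ := exists_control_uniform (T := T) hL hb hσ hσ0 M ha hψ.nonneg hε
  set B := max |b 0| |σ 0|
  have hB : 0 ≤ B := (abs_nonneg _).trans (le_max_left _ _)
  set R := (B + L * M) * (√((spaceTimeMeasure T).real univ) + a) with hR
  have hR0 : 0 ≤ R := by positivity
  have hc := duhamel_green_testSource_pos hT hx₀
  obtain ⟨ε', hε', htrans⟩ := exists_transfer_path hT.le hR0 hψ.nonneg hc
    (show 0 < η / 3 by positivity)
  -- R + C bounds the corrected source because |d| ≤ η/3 ≤ 1.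
  obtain ⟨δ, hδ, hmod⟩ := exists_abs_duhamel_green_sub_le hT.le (R + 1 * C)
    (show 0 < η / 3 by positivity)
  filter_upwards [eventually_gt_atTop 0, eventually_hasL2Bound_discGreen_sub T hε',
    eventually_abs_discInitialPart_sub_le hu hu0 hu1 hv T hε',
    eventually_abs_discInitialPart_sub_le hu hu0 hu1 hv T one_pos,
    eventually_abs_path_kappa_sub_le (hwc.continuousOn (s := spaceTime T))
      (show 0 < η / 3 by positivity),
    (tendsto_one_div_atTop_nhds_zero_nat (𝕜 := ℝ)).eventually (ge_mem_nhds hδ)]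
    with n hn hG hw hw1 hκ hnδ f h hf hfy hsol hh
  rw [isDiscSkeleton_iff hn hT.le hL hb hσ hf] at hsol
  have hmaps : MapsTo (kappa n) (Icc 0 1) (Icc 0 1) := fun z => kappa_mem hn
  have hfM : ∀ p ∈ spaceTime T, |f p| ≤ M := hM (discGreen n) (discInitialPart n u₀ v₀) (kappa n)
    h f (isKernel_discGreen n) (fun t ht x hx => by
      have h1 := hw1 t ht x
      have h2 := hW (t, x) ⟨ht, hx⟩
      have h3 := abs_add_le (discInitialPart n u₀ v₀ t x - initialPart u₀ v₀ t x)
        (initialPart u₀ v₀ t x)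
      rw [sub_add_cancel] at h3
      exact h3.trans (by linarith)) (measurable_kappa n) hmaps hh hf hsol
  have hqm := aestronglyMeasurable_comp_proj hf (measurable_kappa n) hmaps
  have hqM : ∀ p ∈ spaceTime T, |f (p.1, kappa n p.2)| ≤ M := fun p hp =>
    hfM _ ⟨hp.1, hmaps hp.2⟩
  have hF := (hasL2Bound_drift hL hb hσ (le_max_left |b 0| |σ 0|) (le_max_right |b 0| |σ 0|)
    hqm hM0 hqM h).mono (show _ ≤ R by rw [hR]; gcongr)
  set F : ℝ × ℝ → ℝ := fun p => b (f (p.1, kappa n p.2)) + σ (f (p.1, kappa n p.2)) * h p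
    with hFdef
  obtain ⟨d, hd, hval, hclose⟩ := htrans (discGreen n) green (discInitialPart n u₀ v₀)
    (initialPart u₀ v₀) F (testSource T) x₀ (isKernel_discGreen n) isKernel_green
    (fun t ht x => by rw [abs_sub_comm]; exact hw t ht x)
    (fun t ht x => by
      have h1 := hG t ht x
      refine ⟨(hasL2Bound_green t x).aesm.sub (hasL2Bound_discGreen n t x).aesm, h1.nonneg, ?_⟩
      exact (eLpNorm_sub_comm _ _ _ _).le.trans h1.le) hF hψ (le_abs_self _)
  have hFd : HasL2Bound (spaceTimeMeasure T) (fun p => F p + d * testSource T p) (R + 1 * C) :=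
    hF.add (hψ.of_abs_le_mul zero_le_one (hψ.aesm.const_mul d) (ae_of_all _ fun p => by
      rw [abs_mul]
      gcongr
      linarith))
  set D : ℝ × ℝ → ℝ := fun p =>
    duhamel T green (fun p => F p + d * testSource T p) p.1 p.2 with hD
  set f' : ℝ × ℝ → ℝ := fun p => initialPart u₀ v₀ p.1 p.2 + D p with hf'
  have hf'c : ContinuousOn f' (spaceTime T) :=
    (hwc.add (continuous_duhamel_green hT.le hFd)).continuousOn
  have hdist : ∀ p ∈ spaceTime T, |f' p - f p| ≤ η / 3 := fun p hp => by
    have h1 := hclose p.1 hp.1 p.2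
    rwa [← hsol p.1 hp.1 p.2 hp.2] at h1
  have hDosc : ∀ p : ℝ × ℝ, |D (p.1, kappa n p.2) - D p| ≤ η / 3 := fun p =>
    hmod _ hFd p.1 (kappa n p.2) p.1 p.2 (by simpa using hδ.le)
      ((abs_kappa_sub_le hn p.2).trans hnδ)
  -- The discrete path f varies with n and h, so the step from grid point to point is made on f',
  -- whose modulus of continuity is uniform: one third each for f - f' at the grid point, the
  -- initial part and the Duhamel part.
  have hosc : ∀ p ∈ spaceTime T, |f (p.1, kappa n p.2) - f' p| ≤ η := fun p hp => by
    have h1 := abs_le.1 (hdist (p.1, kappa n p.2) ⟨hp.1, hmaps hp.2⟩)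
    have h2 := abs_le.1 (hκ p hp)
    have h3 := abs_le.1 (hDosc p)
    have e : f' (p.1, kappa n p.2) - f' p
        = (initialPart u₀ v₀ p.1 (kappa n p.2) - initialPart u₀ v₀ p.1 p.2)
          + (D (p.1, kappa n p.2) - D p) := add_sub_add_comm _ _ _ _
    rw [abs_le]
    constructor <;> linarith [h1.1, h1.2, h2.1, h2.2, h3.1, h3.2]
  obtain ⟨h', hh', hae⟩ := hctrl (fun p => f (p.1, kappa n p.2)) f' (testSource T) h d hqm
    (hf'c.aestronglyMeasurable (measurableSet_spaceTime T)) hqM hosc hψ hh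
    (hd.trans (by linarith))
  refine ⟨f', h', hf'c, ?_, ?_, hh'⟩
  · rw [← hfy, hsol T ⟨hT.le, le_rfl⟩ x₀ (Ioo_subset_Icc_self hx₀)]
    exact hval
  · rw [isSkeleton_iff hT.le hL hb hσ hf'c]
    intro t _ x _
    have hae' := duhamel_congr (G := green) hae t x
    simp only [id_eq, Prod.mk.eta]
    rw [hae']

lemma continuous_rate : Continuous fun r : ℝ => ENNReal.ofReal (1 / 2 * r ^ 2) :=
  ENNReal.continuous_ofReal.comp (by fun_prop)

lemma pointRate_lt_iff {c : ℝ≥0∞} : pointRate T x₀ u₀ v₀ b σ y < c ↔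
    ∃ (f : ℝ × ℝ → ℝ) (h : Control T), ContinuousOn f (spaceTime T) ∧ f (T, x₀) = y ∧
      IsSkeleton T u₀ v₀ b σ h f ∧ ENNReal.ofReal (1 / 2 * ‖h‖ ^ 2) < c := by
  simp only [pointRate, pathRate, iInf_lt_iff]
  constructor
  · rintro ⟨f, hf, hy, h, hs, hlt⟩
    exact ⟨f, h, hf, hy, hs, hlt⟩
  · rintro ⟨f, h, hf, hy, hs, hlt⟩
    exact ⟨f, hf, hy, h, hs, hlt⟩

lemma discPointRate_lt_iff {n : ℕ} {c : ℝ≥0∞} : discPointRate n T x₀ u₀ v₀ b σ y < c ↔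
    ∃ (f : ℝ × ℝ → ℝ) (h : Control T), ContinuousOn f (spaceTime T) ∧ f (T, x₀) = y ∧
      IsDiscSkeleton n T u₀ v₀ b σ h f ∧ ENNReal.ofReal (1 / 2 * ‖h‖ ^ 2) < c := by
  simp only [discPointRate, discPathRate, iInf_lt_iff]
  constructor
  · rintro ⟨f, hf, hy, h, hs, hlt⟩
    exact ⟨f, h, hf, hy, hs, hlt⟩
  · rintro ⟨f, h, hf, hy, hs, hlt⟩
    exact ⟨f, hf, hy, h, hs, hlt⟩

lemma tendsto_discPointRate (hT : 0 < T) (hx₀ : x₀ ∈ Ioo (0 : ℝ) 1)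
    (hu : ContDiffOn ℝ 2 u₀ (Icc 0 1)) (hu0 : u₀ 0 = 0) (hu1 : u₀ 1 = 0)
    (hv : ContinuousOn v₀ (Icc 0 1)) (hL : 0 ≤ L) (hb : ∀ x y, |b x - b y| ≤ L * |x - y|)
    (hσ : ∀ x y, |σ x - σ y| ≤ L * |x - y|) (hσ0 : ∀ x, σ x ≠ 0) (y : ℝ) :
    Tendsto (fun n : ℕ => discPointRate n T x₀ u₀ v₀ b σ y) atTop
      (𝓝 (pointRate T x₀ u₀ v₀ b σ y)) := by
  rw [tendsto_order]
  constructor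
  · intro c hc
    -- Lower bound. The level c' is finite even if the limit is ∞, so it bounds the norms of the
    -- competing discrete controls by a, where a²/2 = c'. If Iⁿ(y) ≤ c, a transferred control has
    -- norm at most a + ε/2 and rate below I(y), a contradiction.
    obtain ⟨c', hcc', hc'⟩ := exists_between hc
    have hc't : c' ≠ ⊤ := (hc'.trans_le le_top).ne
    set a := √(2 * c'.toReal) with ha
    have ha0 : 0 ≤ a := Real.sqrt_nonneg _
    have hac : ENNReal.ofReal (1 / 2 * a ^ 2) = c' := by
      rw [ha, Real.sq_sqrt (by positivity), one_div, inv_mul_cancel_left₀ two_ne_zero,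
        ENNReal.ofReal_toReal hc't]
    have hnear := (continuous_rate.tendsto a).eventually (gt_mem_nhds (by
      rw [hac]; exact hc'))
    obtain ⟨ε, hε, hball⟩ := Metric.eventually_nhds_iff.1 hnear
    filter_upwards [eventually_exists_skeleton (y := y) hT hx₀ hu hu0 hu1 hv hL hb hσ hσ0 ha0
      (half_pos hε)] with n hn
    by_contra hle
    obtain ⟨f, h, hf, hfy, hsol, hlt⟩ := discPointRate_lt_iff.1 ((not_lt.1 hle).trans_lt hcc')
    have hha : ‖h‖ ≤ a := by
      rw [← hac] at hlt
      have h1 := (ENNReal.ofReal_lt_ofReal_iff_of_nonneg (by positivity)).1 hlt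
      exact le_of_sq_le_sq (by linarith) ha0
    obtain ⟨f', h', hf', hfy', hsol', hh'⟩ := hn f h hf hfy hsol hha
    have hh'a : ‖h'‖ ≤ a + ε / 2 := by
      have := norm_le_norm_add_norm_sub' h' h
      linarith
    have h1 : ENNReal.ofReal (1 / 2 * ‖h'‖ ^ 2) < pointRate T x₀ u₀ v₀ b σ y := by
      refine lt_of_le_of_lt ?_ (hball (y := a + ε / 2) ?_)
      · gcongr
      · rw [Real.dist_eq, add_sub_cancel_left, abs_of_pos (half_pos hε)]
        exact half_lt_self hε
    exact lt_irrefl _ (pointRate_lt_iff.2 ⟨f', h', hf', hfy', hsol', h1⟩)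
  · intro c hc
    -- Upper bound: a single control of rate below c is transferred, and its rate stays below c by
    -- continuity.
    obtain ⟨f, h, hf, hfy, hsol, hlt⟩ := pointRate_lt_iff.1 hc
    obtain ⟨ε, hε, hball⟩ := Metric.eventually_nhds_iff.1
      ((continuous_rate.tendsto ‖h‖).eventually (gt_mem_nhds hlt))
    filter_upwards [eventually_exists_discSkeleton hT hx₀ hu hu0 hu1 hv hL hb hσ hσ0 hf hfy hsol
      (half_pos hε)] with n hn
    obtain ⟨f', h', hf', hfy', hsol', hh'⟩ := hn
    refine discPointRate_lt_iff.2 ⟨f', h', hf', hfy', hsol', hball ?_⟩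
    rw [Real.dist_eq]
    exact ((abs_norm_sub_norm_le h' h).trans hh').trans_lt (half_lt_self hε)

end Rate

end

end WaveLDP

theorem theorem3p3
    (T : ℝ) (hT : 0 < T)
    (x₀ : ℝ) (hx₀ : x₀ ∈ Ioo (0 : ℝ) 1)
    (u₀ v₀ b σ : ℝ → ℝ)
    (hu₀ : ContDiffOn ℝ 2 u₀ (Icc 0 1)) (hu₀0 : u₀ 0 = 0) (hu₀1 : u₀ 1 = 0)
    (hv₀ : ContDiffOn ℝ 1 v₀ (Icc 0 1))
    (hLip : ∃ L > 0, ∀ x y : ℝ, |b x - b y| + |σ x - σ y| ≤ L * |x - y|)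
    (hσ : ∀ x : ℝ, σ x ≠ 0)
    (y : ℝ) :
    Tendsto (fun n : ℕ => WaveLDP.discPointRate n T x₀ u₀ v₀ b σ y) atTop
      (𝓝 (WaveLDP.pointRate T x₀ u₀ v₀ b σ y)) := by
  obtain ⟨L, hL, hbσ⟩ := hLip
  have hb : ∀ x y : ℝ, |b x - b y| ≤ L * |x - y| := fun x y =>
    (le_add_of_nonneg_right (abs_nonneg _)).trans (hbσ x y)
  have hσL : ∀ x y : ℝ, |σ x - σ y| ≤ L * |x - y| := fun x y =>
    (le_add_of_nonneg_left (abs_nonneg _)).trans (hbσ x y)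
  exact WaveLDP.tendsto_discPointRate hT hx₀ hu₀ hu₀0 hu₀1 hv₀.continuousOn hL.le hb hσL hσ y
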